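/- A *Galois structure* $\Gamma=(\mathbb{C},\mathbb{X},I,H,\eta,\mathcal{E})$ consists of a category $\mathbb{C}$, a full replete reflective subcategory $\mathbb{X}$ of $\mathbb{C}$ with inclusion functor $H\colon\mathbb{X}\to\mathbb{C}$, left adjoint $I\colon\mathbb{C}\to\mathbb{X}$ and reflection unit $\eta_A\colon A\to HI(A)$, and a class $\mathcal{E}$ of morphisms of $\mathbb{C}$ such that (E1) $\mathcal{E}$ contains all isomorphisms; (E2) the pullback of a morphism in $\mathcal{E}$ along any morphism of $\mathbb{C}$ exists and lies in $\mathcal{E}$; (E3) $\mathcal{E}$ is closed under composition; (G) $HI(\mathcal{E})\subseteq\mathcal{E}$. For an object $B$, let $(\mathbb{C}\downarrow B)$ be the full subcategory of the slice category $\mathbb{C}/B$ whose objects are the $f\colon A\to B$ in $\mathcal{E}$. A *monadic extension* is a morphism $p\colon E\to B$ in $\mathcal{E}$ whose pullback functor $p^*\colon(\mathbb{C}\downarrow B)\to(\mathbb{C}\downarrow E)$ is monadic. A *trivial covering* is a morphism $f\colon A\to B$ in $\mathcal{E}$ whose naturality square $HI(f)\circ\eta_A=\eta_B\circ f$ is a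 pullback. A *covering* is a morphism $f\colon A\to B$ in $\mathcal{E}$ for which there is a monadic extension $p\colon E\to B$ such that $p^*(A,f)$ is a trivial covering of $E$. Let $\mathrm{Ext}(\mathbb{C})$ be the full subcategory of the arrow category $\mathrm{Arr}(\mathbb{C})$ whose objects are the morphisms in $\mathcal{E}$, and $\mathrm{Cov}_\Gamma(\mathbb{C})$ the full subcategory of $\mathrm{Ext}(\mathbb{C})$ whose objects are the coverings. Let $\mathcal{E}^1$ be the class of those morphisms $(f',f)\colon a\to b$ of $\mathrm{Ext}(\mathbb{C})$ (commutative squares $b\circ f'=f\circ a$) such that $f$ and $f'$ lie in $\mathcal{E}$ and the pullback of $(f',f)$ along any morphism of $\mathrm{Ext}(\mathbb{C})$ exists and is preserved by the inclusion $\mathrm{Ext}(\mathbb{C})\to\mathrm{Arr}(\mathbb{C})$. Consider the following conditions on $\Gamma$: - (E4) if $g\circ f\in\mathcal{E}$, then $g\in\mathcal{E}$; - (E5) every split epimorphism of $\mathrm{Ext}(\mathbb{C})$ lies in $\mathcal{E}^1$; - (M) every morphism in $\mathcal{E}$ is a monadic extension; - (B) $\mathbb{X}$ is a *strongly $\mathcal{E}$-Birkhoff*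 subcategory of $\mathbb{C}$: for every $f\colon A\to B$ in $\mathcal{E}$, the naturality square $HI(f)\circ\eta_A=\eta_B\circ f$, viewed as a morphism $(\eta_A,\eta_B)\colon f\to HI(f)$ of $\mathrm{Ext}(\mathbb{C})$, lies in $\mathcal{E}^1$. **Lemma.** Let $\Gamma=(\mathbb{C},\mathbb{X},I,H,\eta,\mathcal{E})$ be a Galois structure that satisfies (E4), (E5), (M) and (B). Then the inclusion $H_1\colon\mathrm{Cov}_\Gamma(\mathbb{C})\to\mathrm{Ext}(\mathbb{C})$ has a left adjoint $I_1$, with unit $\eta^1$ say, such that $\Gamma_1=(\mathrm{Ext}(\mathbb{C}),\mathrm{Cov}_\Gamma(\mathbb{C}),I_1,H_1,\eta^1,\mathcal{E}^1)$ is a Galois structure; and, whatever the choice of the left adjoint $I_1$, any such Galois structure $\Gamma_1$ satisfies (B), i.e. $\mathrm{Cov}_\Gamma(\mathbb{C})$ is a strongly $\mathcal{E}^1$-Birkhoff subcategory of $\mathrm{Ext}(\mathbb{C})$. -/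

import Mathlib

open CategoryTheory CategoryTheory.Limits

universe v u

/-- For a class `E` of morphisms of `C`, the category `Ext(C)`: the full subcategory of the arrow
category of `C` whose objects are the morphisms in `E`. -/
abbrev ExtCat {C : Type u} [Category.{v} C] (E : MorphismProperty C) : Type (max u v) :=
  ObjectProperty.FullSubcategory (fun f : Arrow C => E f.hom)

namespace ExtCat

/-- The inclusion functor of `Ext(C)` into the arrow category. -/
abbrev incl {C : Type u} [Category.{v} C] (E : MorphismProperty C) : ExtCat E ⥤ Arrow C :=
  ObjectProperty.ι (fun f : Arrow C => E f.hom)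

/-- A morphism in `E`, as an object of `Ext(C)`. -/
abbrev mk {C : Type u} [Category.{v} C] {E : MorphismProperty C} {A B : C} (f : A ⟶ B)
    (hf : E f) : ExtCat E :=
  ⟨Arrow.mk f, hf⟩

/-- A commutative square of `C` whose sides `f` and `g` are in `E`, as a morphism of `Ext(C)`. -/
abbrev homMk {C : Type u} [Category.{v} C] {E : MorphismProperty C} {A B A' B' : C}
    {f : A ⟶ B} {g : A' ⟶ B'} (hf : E f) (hg : E g) (top : A ⟶ A') (bot : B ⟶ B')
    (w : top ≫ g = f ≫ bot) : mk f hf ⟶ mk g hg :=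
  ObjectProperty.homMk (Arrow.homMk top bot w)

end ExtCat

/-- The class `E¹` of morphisms of `Ext(C)`: a morphism `φ : a ⟶ b`, that is, a commutative square
in `C`, belongs to `E¹` when both of its components belong to `E` and its pullback along any
morphism of `Ext(C)` exists in `Ext(C)` and is preserved by the inclusion `Ext(C) ⥤ Arr(C)`. -/
def extClass {C : Type u} [Category.{v} C] (E : MorphismProperty C) :
    MorphismProperty (ExtCat E) :=
  fun _ b φ => E φ.hom.left ∧ E φ.hom.right ∧
    ∀ ⦃c : ExtCat E⦄ (ψ : c ⟶ b),
      HasPullback φ ψ ∧ PreservesLimit (cospan φ ψ) (ExtCat.incl E)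

/-- Condition (E4). -/
def CondE4 {C : Type u} [Category.{v} C] (E : MorphismProperty C) : Prop :=
  ∀ ⦃A B D : C⦄ (f : A ⟶ B) (g : B ⟶ D), E (f ≫ g) → E g

/-- Condition (E5): split epimorphisms of `Ext(C)` belong to `E¹`. -/
def CondE5 {C : Type u} [Category.{v} C] (E : MorphismProperty C) : Prop :=
  ∀ ⦃a b : ExtCat E⦄ (φ : a ⟶ b) (s : b ⟶ a), s ≫ φ = 𝟙 b → extClass E φ

/-- A Galois structure on `C`: a full replete reflective subcategory `X` with a chosen
reflector `I` (left adjoint to the inclusion), and a class `E` of morphisms subject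
to (E1), (E2), (E3) and (G). -/
structure GaloisStructure (C : Type u) [Category.{v} C] where
  /-- the objects of the subcategory -/
  X : ObjectProperty C
  replete : X.IsClosedUnderIsomorphisms
  /-- the reflector -/
  I : C ⥤ X.FullSubcategory
  /-- the reflection -/
  adj : I ⊣ X.ι
  /-- the class of morphisms -/
  E : MorphismProperty C
  /-- (E1) -/
  iso_mem : ∀ ⦃A B : C⦄ (f : A ⟶ B), IsIso f → E f
  /-- (E2), existence of pullbacks -/
  hasPullback : ∀ ⦃A B D : C⦄ (f : A ⟶ B) (g : D ⟶ B), E f → HasPullback f g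
  /-- (E2), stability under pullbacks -/
  stable : E.IsStableUnderBaseChange
  /-- (E3) -/
  comp_mem : ∀ ⦃A B D : C⦄ (f : A ⟶ B) (g : B ⟶ D), E f → E g → E (f ≫ g)
  /-- (G) -/
  map_mem : ∀ ⦃A B : C⦄ (f : A ⟶ B), E f → E ((I ⋙ X.ι).map f)

namespace GaloisStructure

variable {C : Type u} [Category.{v} C] (Γ : GaloisStructure C)

instance isStableUnderBaseChange : Γ.E.IsStableUnderBaseChange := Γ.stable

instance hasPullbacksAlong {A B : C} (p : A ⟶ B) : Γ.E.HasPullbacksAlong p where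
  hasPullback g hg := Γ.hasPullback g p hg

/-- The composite endofunctor `HI` of `C`. -/
abbrev HI : C ⥤ C := Γ.I ⋙ Γ.X.ι

/-- The reflection unit. -/
abbrev η : 𝟭 C ⟶ Γ.HI := Γ.adj.unit

/-- The category `(C ↓ B)`: the full subcategory of the slice category `C / B` given by the
morphisms in `E`. -/
abbrev Slice (B : C) := Γ.E.Over ⊤ B

/-- The pullback functor `p* : (C ↓ B) ⥤ (C ↓ A)` along `p : A ⟶ B`. -/
noncomputable abbrev pullbackFunctor {A B : C} (p : A ⟶ B) : Γ.Slice B ⥤ Γ.Slice A :=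
  MorphismProperty.Over.pullback Γ.E ⊤ p

/-- Monadic extensions: morphisms `p` in `E` whose pullback functor is monadic. -/
def IsMonadicExtension {A B : C} (p : A ⟶ B) : Prop :=
  Γ.E p ∧ Nonempty (MonadicRightAdjoint (Γ.pullbackFunctor p))

/-- Trivial coverings: morphisms in `E` whose naturality square for the unit is a pullback. -/
def IsTrivialCovering {A B : C} (f : A ⟶ B) : Prop :=
  Γ.E f ∧ IsPullback (Γ.η.app A) f (Γ.HI.map f) (Γ.η.app B)

/-- The object `(A, f)` of `(C ↓ B)` is split by `p : D ⟶ B` when `p*(A, f)` is a trivial covering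
of `D`. -/
def IsSplitBy {B D : C} (a : Γ.Slice B) (p : D ⟶ B) : Prop :=
  Γ.IsTrivialCovering ((Γ.pullbackFunctor p).obj a).hom

/-- Coverings: morphisms in `E` that are split by some monadic extension. -/
def IsCovering {A B : C} (f : A ⟶ B) : Prop :=
  ∃ hf : Γ.E f, ∃ (D : C) (p : D ⟶ B), Γ.IsMonadicExtension p ∧
    Γ.IsSplitBy (MorphismProperty.Over.mk ⊤ f hf) p

/-- The coverings, as a class of objects of `Ext(C)`; the corresponding full subcategory
of `Ext(C)` is `Cov(C)`. -/
def Cov : ObjectProperty (ExtCat Γ.E) := fun a => Γ.IsCovering a.obj.hom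

/-- The naturality square of the reflection unit at a morphism `f` in `E`, as a
morphism `f ⟶ HI(f)` of `Ext(C)`. -/
abbrev unitSquare {A B : C} (f : A ⟶ B) (hf : Γ.E f) :
    ExtCat.mk f hf ⟶ ExtCat.mk (Γ.HI.map f) (Γ.map_mem f hf) :=
  ExtCat.homMk hf (Γ.map_mem f hf) (Γ.η.app A) (Γ.η.app B) (Γ.η.naturality f).symm

/-- Condition (M): every morphism in `E` is a monadic extension. -/
def CondM : Prop :=
  ∀ ⦃A B : C⦄ (p : A ⟶ B), Γ.E p → Γ.IsMonadicExtension p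

/-- Condition (B): the subcategory is strongly `E`-Birkhoff. -/
def CondB : Prop :=
  ∀ ⦃A B : C⦄ (f : A ⟶ B) (hf : Γ.E f), extClass Γ.E (Γ.unitSquare f hf)

end GaloisStructure

/-! Under (M), a morphism in `E` behaves, relative to `E`, like an effective descent morphism:
pullback along it is faithful, reflects isomorphisms and descends quotients that carry an action. So
a monomorphism in `E` is invertible (`CondM.isIso`). A square lies in `E¹` exactly when its
components and its comparison with the pullback lie in `E` (`extClass_of_comparison`,
`extClass.comparison`), which turns (E5), (B) and the conclusion into statements about comparisons.

By (B), a morphism in `E` that is jointly monic with the unit is a trivial covering. By (E5), `HI`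
preserves pullbacks of split epimorphisms in `E` along morphisms in `E` (`isPullback_map`); hence
split coverings are trivial.

To reflect `f : A ⟶ B`, let `R` be its kernel pair and `T ⟶ A` the trivial covering obtained from
the first projection. The diagonal splits this projection, so `HI` preserves the object of
composable pairs and composition in `R` induces a descent datum on `T`. It descends to a covering of
`B` (`exists_coveringReflection`). A covering through which `f` factors becomes split, hence
trivial, after pullback along `f`; this gives the universal property
(`CoveringReflection.exists_desc`).

The Birkhoff property asks that the comparison of a unit square be in `E¹`. In `comparison_mem` this
is moved to kernel pairs, where (E5) applies to a split square formed by comparisons that (B) puts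
in `E`; (E4) brings the result back. -/

section Monadic

-- Morphisms and quotients in the image of a monadic functor

universe v₁ v₂ u₁ u₂

variable {D : Type u₁} [Category.{v₁} D] {K : Type u₂} [Category.{v₂} K] {G : D ⥤ K}

/-- A monadic functor is full on the morphisms that commute with the canonical actions. -/
theorem CategoryTheory.MonadicRightAdjoint.exists_map_eq [MonadicRightAdjoint G] {F : K ⥤ D}
    (adj : F ⊣ G) {Y Z : D} (k : G.obj Y ⟶ G.obj Z)
    (hk : G.map (F.map k) ≫ G.map (adj.counit.app Z) = G.map (adj.counit.app Y) ≫ k) :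
    ∃ w : Y ⟶ Z, G.map w = k := by
  let adj' := monadicAdjunction G
  let i := adj'.leftAdjointUniq adj
  have hi (X : D) : adj'.counit.app X = i.hom.app (G.obj X) ≫ adj.counit.app X :=
    (Adjunction.leftAdjointUniq_hom_app_counit adj' adj X).symm
  let k' : (Monad.comparison adj').obj Y ⟶ (Monad.comparison adj').obj Z :=
    { f := k
      h := by
        change G.map ((monadicLeftAdjoint G).map k) ≫ G.map (adj'.counit.app Z) =
          G.map (adj'.counit.app Y) ≫ k
        rw [hi, hi, G.map_comp, G.map_comp, Category.assoc, ← hk, ← G.map_comp_assoc,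
          i.hom.naturality, G.map_comp_assoc] }
  exact ⟨(Monad.comparison adj').preimage k',
    congrArg Monad.Algebra.Hom.f ((Monad.comparison adj').map_preimage k')⟩

/-- A quotient `t` of an object in the image of a monadic functor, together with a compatible
action, lies in the image of that functor. -/
theorem CategoryTheory.Monad.exists_desc {F : K ⥤ D} (adj : F ⊣ G)
    [(Monad.comparison adj).IsEquivalence] {X : D} {T : K} (t : G.obj X ⟶ T)
    (m : G.obj (F.obj T) ⟶ T) (hm : G.map (F.map t) ≫ m = G.map (adj.counit.app X) ≫ t) [Epi t]
    [Epi (G.map (F.map (G.map (F.map t))))] :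
    ∃ (Y : D) (w : X ⟶ Y) (e : G.obj Y ≅ T), G.map w ≫ e.hom = t := by
  have hcounit {U V : D} (a : U ⟶ V) {Z : K} (b : G.obj V ⟶ Z) :
      G.map (F.map (G.map a)) ≫ G.map (adj.counit.app V) ≫ b =
        G.map (adj.counit.app U) ≫ G.map a ≫ b := by
    have h := adj.counit.naturality a
    dsimp at h
    rw [← G.map_comp_assoc, h, G.map_comp_assoc]
  -- Both algebra laws are checked after precomposition with an epimorphism, where `hm` reduces them
  -- to the laws of the canonical action on `G.obj X`.
  let A : adj.toMonad.Algebra :=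
    { A := T
      a := m
      unit := by
        change adj.unit.app T ≫ m = 𝟙 T
        rw [← cancel_epi t, Category.comp_id, ← adj.unit_naturality_assoc, hm,
          adj.right_triangle_components_assoc]
      assoc := by
        change G.map (adj.counit.app (F.obj T)) ≫ m = G.map (F.map m) ≫ m
        rw [← cancel_epi (G.map (F.map (G.map (F.map t)))), hcounit, hm,
          ← G.map_comp_assoc (F.map _) (F.map m), ← F.map_comp, hm, F.map_comp, G.map_comp_assoc,
          hm]
        exact (hcounit (adj.counit.app X) t).symm }
  let t' : (Monad.comparison adj).obj X ⟶ A := { f := t, h := hm }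
  let j := (Monad.comparison adj).objObjPreimageIso A
  refine ⟨_, (Monad.comparison adj).preimage (t' ≫ j.inv), (Monad.forget _).mapIso j, ?_⟩
  have h1 : G.map ((Monad.comparison adj).preimage (t' ≫ j.inv)) = t ≫ j.inv.f :=
    congrArg Monad.Algebra.Hom.f ((Monad.comparison adj).map_preimage (t' ≫ j.inv))
  have h2 : j.inv.f ≫ j.hom.f = 𝟙 _ := congrArg Monad.Algebra.Hom.f j.inv_hom_id
  change _ ≫ j.hom.f = t
  rw [h1, Category.assoc, h2, Category.comp_id]

/-- Left adjoints are unique up to isomorphism, so the action and the epimorphism hypothesis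
transport to the left adjoint that monadicity supplies. In use, `F` is composition with `p`. -/
theorem CategoryTheory.MonadicRightAdjoint.exists_desc [MonadicRightAdjoint G] {F : K ⥤ D}
    (adj : F ⊣ G) {X : D} {T : K} (t : G.obj X ⟶ T) (m : G.obj (F.obj T) ⟶ T)
    (hm : G.map (F.map t) ≫ m = G.map (adj.counit.app X) ≫ t) [Epi t]
    [Epi (G.map (F.map (G.map (F.map t))))] :
    ∃ (Y : D) (w : X ⟶ Y) (e : G.obj Y ≅ T), G.map w ≫ e.hom = t := by
  let i := (monadicAdjunction G).leftAdjointUniq adj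
  let j : monadicLeftAdjoint G ⋙ G ≅ F ⋙ G := Functor.isoWhiskerRight i G
  have : Epi (((monadicLeftAdjoint G ⋙ G) ⋙ monadicLeftAdjoint G ⋙ G).map t) := by
    rw [← NatIso.naturality_2 (NatIso.hcomp j j : (_ ⋙ G) ⋙ _ ⋙ G ≅ (F ⋙ G) ⋙ F ⋙ G) t]
    have : Epi (((F ⋙ G) ⋙ F ⋙ G).map t) := by assumption
    infer_instance
  have : Epi (G.map ((monadicLeftAdjoint G).map (G.map ((monadicLeftAdjoint G).map t)))) := this
  refine Monad.exists_desc (monadicAdjunction G) t (G.map (i.hom.app T) ≫ m) ?_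
  rw [← Adjunction.leftAdjointUniq_hom_app_counit (monadicAdjunction G) adj X, G.map_comp,
    Category.assoc, ← hm, ← G.map_comp_assoc, i.hom.naturality, G.map_comp_assoc]

theorem CategoryTheory.MonadicRightAdjoint.faithful [MonadicRightAdjoint G] : G.Faithful :=
  ⟨fun h ↦ (Monad.comparison (monadicAdjunction G)).map_injective (Monad.Algebra.Hom.ext h)⟩

theorem CategoryTheory.MonadicRightAdjoint.reflectsIsomorphisms [MonadicRightAdjoint G] :
    G.ReflectsIsomorphisms :=
  ⟨fun f hf ↦ by
    have : IsIso (((Monad.comparison (monadicAdjunction G)) ⋙ Monad.forget _).map f) := hf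
    exact isIso_of_reflects_iso f (Monad.comparison (monadicAdjunction G) ⋙ Monad.forget _)⟩

end Monadic

/-! ### Descent in slices along monadic extensions -/

namespace GaloisStructure

variable {C : Type u} [Category.{v} C] {Γ : GaloisStructure C}

instance isMultiplicative (Γ : GaloisStructure C) : Γ.E.IsMultiplicative where
  id_mem _ := Γ.iso_mem _ inferInstance
  comp_mem f g := Γ.comp_mem f g

namespace Slice

theorem isIso_of_left {B : C} {X Y : Γ.Slice B} (φ : X ⟶ Y) [IsIso φ.left] : IsIso φ := by
  have : IsIso ((MorphismProperty.Over.forget Γ.E ⊤ B ⋙ Over.forget B).map φ) := by assumption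
  exact isIso_of_reflects_iso φ (MorphismProperty.Over.forget Γ.E ⊤ B ⋙ Over.forget B)

theorem isIso_left {B : C} {X Y : Γ.Slice B} (φ : X ⟶ Y) [IsIso φ] : IsIso φ.left :=
  inferInstanceAs (IsIso ((MorphismProperty.Over.forget Γ.E ⊤ B ⋙ Over.forget B).map φ))

theorem comp_left {B : C} {X Y Z : Γ.Slice B} (φ : X ⟶ Y) (ψ : Y ⟶ Z) :
    (φ ≫ ψ).left = φ.left ≫ ψ.left := rfl

theorem w {B : C} {X Y : Γ.Slice B} (φ : X ⟶ Y) : φ.left ≫ Y.hom = X.hom :=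
  MorphismProperty.Over.w φ

/-- The projection of the pullback of a slice object. -/
noncomputable def proj {A B : C} (p : A ⟶ B) (X : Γ.Slice B) :
    ((Γ.pullbackFunctor p).obj X).left ⟶ X.left :=
  pullback.fst X.hom p

theorem isPullback_proj {A B : C} (p : A ⟶ B) (X : Γ.Slice B) :
    IsPullback (proj p X) ((Γ.pullbackFunctor p).obj X).hom X.hom p :=
  IsPullback.of_hasPullback X.hom p

theorem map_left_proj {A B : C} (p : A ⟶ B) {X Y : Γ.Slice B} (φ : X ⟶ Y) :
    ((Γ.pullbackFunctor p).map φ).left ≫ proj p Y = proj p X ≫ φ.left :=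
  pullback.lift_fst _ _ _

/-- The functor `(C ↓ A) ⥤ (C ↓ B)` given by composition with a morphism in `E`. -/
abbrev map {A B : C} {p : A ⟶ B} (hp : Γ.E p) : Γ.Slice A ⥤ Γ.Slice B :=
  MorphismProperty.Over.map ⊤ hp

/-- The pullback functor along a morphism in `E` is right adjoint to composition. -/
noncomputable abbrev mapPullbackAdj {A B : C} {p : A ⟶ B} (hp : Γ.E p) :
    map hp ⊣ Γ.pullbackFunctor p :=
  MorphismProperty.Over.mapPullbackAdj Γ.E ⊤ p hp trivial

end Slice

open Slice

variable {A B : C} {p : A ⟶ B}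

theorem IsMonadicExtension.ext (hp : Γ.IsMonadicExtension p) {X Y : Γ.Slice B} {g h : X ⟶ Y}
    (e : proj p X ≫ g.left = proj p X ≫ h.left) : g = h := by
  obtain ⟨-, ⟨_⟩⟩ := hp
  have := MonadicRightAdjoint.faithful (G := Γ.pullbackFunctor p)
  apply (Γ.pullbackFunctor p).map_injective
  ext
  apply (isPullback_proj p Y).hom_ext
  · rw [map_left_proj, map_left_proj, e]
  · rw [w, w]

theorem IsMonadicExtension.isIso (hp : Γ.IsMonadicExtension p) {X Y : Γ.Slice B} (φ : X ⟶ Y)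
    (h : IsIso ((Γ.pullbackFunctor p).map φ).left) : IsIso φ.left := by
  obtain ⟨-, ⟨_⟩⟩ := hp
  have := MonadicRightAdjoint.reflectsIsomorphisms (G := Γ.pullbackFunctor p)
  have := isIso_of_left ((Γ.pullbackFunctor p).map φ)
  have := isIso_of_reflects_iso φ (Γ.pullbackFunctor p)
  exact isIso_left φ

/-- Compatibility with the kernel pair of `proj p X` makes `k` commute with the canonical actions,
so fullness of the comparison functor applies. -/
theorem IsMonadicExtension.exists_hom (hp : Γ.IsMonadicExtension p) {X Y : Γ.Slice B}
    (k : (Γ.pullbackFunctor p).obj X ⟶ (Γ.pullbackFunctor p).obj Y)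
    (hk : ∀ ⦃Z : C⦄ (a b : Z ⟶ ((Γ.pullbackFunctor p).obj X).left),
      a ≫ proj p X = b ≫ proj p X → a ≫ k.left ≫ proj p Y = b ≫ k.left ≫ proj p Y) :
    ∃ φ : X ⟶ Y, proj p X ≫ φ.left = k.left ≫ proj p Y := by
  obtain ⟨hp, ⟨_⟩⟩ := hp
  obtain ⟨φ, hφ⟩ := MonadicRightAdjoint.exists_map_eq (mapPullbackAdj hp) k (by
    ext
    apply (isPullback_proj p Y).hom_ext
    · have h1 := map_left_proj p ((map hp).map k)
      have h2 := map_left_proj p ((mapPullbackAdj hp).counit.app X)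
      have h3 := map_left_proj p ((mapPullbackAdj hp).counit.app Y)
      -- `hk` is applied to the projection and the canonical action, two morphisms to the pullback
      -- of `X` that agree after `proj p X` by `h2`.
      exact (Category.assoc _ _ _).trans ((congrArg (_ ≫ ·) h3).trans
        ((Category.assoc _ _ _).symm.trans ((congrArg (· ≫ proj p Y) h1).trans
        ((Category.assoc _ _ _).trans ((hk (proj p ((map hp).obj ((Γ.pullbackFunctor p).obj X)))
        ((Γ.pullbackFunctor p).map ((mapPullbackAdj hp).counit.app X)).left h2.symm).trans
        (Category.assoc _ _ _).symm)))))
    · exact (w ((Γ.pullbackFunctor p).map ((map hp).map k) ≫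
        (Γ.pullbackFunctor p).map ((mapPullbackAdj hp).counit.app Y))).trans
          (w ((Γ.pullbackFunctor p).map ((mapPullbackAdj hp).counit.app X) ≫ k)).symm)
  exact ⟨φ, by rw [← hφ, map_left_proj]⟩

/-- Pulled back along `p`, the monomorphism `X.hom` acquires a section from `s` and becomes
invertible; `p*` reflects isomorphisms. -/
theorem IsMonadicExtension.isIso_hom (hp : Γ.IsMonadicExtension p) (X : Γ.Slice B) (h : Mono X.hom)
    (s : A ⟶ X.left) (hs : s ≫ X.hom = p) : IsIso X.hom := by
  let Y : Γ.Slice B := MorphismProperty.Over.mk ⊤ (𝟙 B) (Γ.E.id_mem B)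
  have hY : IsIso Y.hom := inferInstanceAs (IsIso (𝟙 B))
  let φ : X ⟶ Y := MorphismProperty.Over.homMk X.hom (Category.comp_id _) trivial
  refine hp.isIso φ ?_
  have h1 := w ((Γ.pullbackFunctor p).map φ)
  have hX := isPullback_proj p X
  have h2 : IsIso ((Γ.pullbackFunctor p).obj Y).hom := (isPullback_proj p Y).isIso_snd_of_isIso
  have h3 : IsIso ((Γ.pullbackFunctor p).obj X).hom := by
    have hs' : s ≫ X.hom = 𝟙 A ≫ p := hs.trans (Category.id_comp _).symm
    refine ⟨hX.lift s (𝟙 A) hs', ?_, hX.lift_snd _ _ _⟩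
    apply hX.hom_ext
    · have h4 := hX.lift_fst s (𝟙 A) hs'
      rw [← cancel_mono X.hom, Category.assoc, Category.assoc, reassoc_of% h4, hs]
      exact hX.w.symm.trans (congrArg (· ≫ X.hom) (Category.id_comp _).symm)
    · rw [Category.assoc, hX.lift_snd]
      exact (Category.comp_id _).trans (Category.id_comp _).symm
  rw [← h1] at h3
  exact IsIso.of_isIso_comp_right _ ((Γ.pullbackFunctor p).obj Y).hom

/-- Under (M), monomorphisms in `E` are invertible. -/
theorem CondM.isIso (hM : Γ.CondM) (hp : Γ.E p) [h : Mono p] : IsIso p :=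
  (hM p hp).isIso_hom (MorphismProperty.Over.mk ⊤ p hp) h (𝟙 A) (Category.id_comp p)

theorem IsMonadicExtension.cancel (hp : Γ.IsMonadicExtension p) {X Y : Γ.Slice B} [IsIso X.hom]
    (s : A ⟶ X.left) (hs : s ≫ X.hom = p) {g h : X ⟶ Y} (e : s ≫ g.left = s ≫ h.left) :
    g = h := by
  refine hp.ext ?_
  have h1 : proj p X = ((Γ.pullbackFunctor p).obj X).hom ≫ s := by
    rw [← cancel_mono X.hom, (isPullback_proj p X).w, Category.assoc, hs]
  rw [h1, Category.assoc, Category.assoc, e]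

/-- Under (M), morphisms in `E` are right cancellable with respect to pairs of morphisms that
are identified by a morphism in `E`. -/
theorem CondM.cancel (hM : Γ.CondM) (hp : Γ.E p) {Z W : C} {z : Z ⟶ W} (hz : Γ.E z)
    {g h : B ⟶ Z} (e : g ≫ z = h ≫ z) (e' : p ≫ g = p ≫ h) : g = h := by
  -- Monadicity only concerns slices, so `p` need not be an epimorphism of the whole category. The
  -- common composite with `z` turns `g` and `h` into two sections over `B` of a pullback of `z`.
  have := Γ.hasPullback z (g ≫ z) hz
  have hg : g ≫ z = 𝟙 B ≫ g ≫ z := (Category.id_comp _).symm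
  have hh : h ≫ z = 𝟙 B ≫ g ≫ z := e.symm.trans hg
  let X : Γ.Slice B := MorphismProperty.Over.mk ⊤ (𝟙 B) (Γ.E.id_mem B)
  let Y : Γ.Slice B :=
    MorphismProperty.Over.mk ⊤ (pullback.snd z (g ≫ z)) (Γ.E.pullback_snd _ _ hz)
  let φ (k : B ⟶ pullback z (g ≫ z)) (hk : k ≫ pullback.snd z (g ≫ z) = 𝟙 B) : X ⟶ Y :=
    MorphismProperty.Over.homMk k hk trivial
  have hX : IsIso X.hom := inferInstanceAs (IsIso (𝟙 B))
  have h2 : p ≫ pullback.lift g (𝟙 B) hg = p ≫ pullback.lift h (𝟙 B) hh := by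
    apply pullback.hom_ext
    · rw [Category.assoc, Category.assoc, pullback.lift_fst, pullback.lift_fst, e']
    · rw [Category.assoc, Category.assoc, pullback.lift_snd, pullback.lift_snd]
  have hφ : φ (pullback.lift g (𝟙 B) hg) (pullback.lift_snd _ _ _) =
      φ (pullback.lift h (𝟙 B) hh) (pullback.lift_snd _ _ _) :=
    (hM p hp).cancel p (Category.comp_id p) h2
  have h3 : pullback.lift g (𝟙 B) hg = pullback.lift h (𝟙 B) hh := congrArg (fun k ↦ k.left) hφ
  rw [← pullback.lift_fst g (𝟙 B) hg, h3, pullback.lift_fst]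

/-- Here `X` is terminal in the slice, so a morphism between the pullbacks amounts to `f`, and its
compatibility condition to `e`. -/
theorem IsMonadicExtension.exists_factor (hp : Γ.IsMonadicExtension p) {X Y : Γ.Slice B}
    [IsIso X.hom] (s : A ⟶ X.left) (hs : s ≫ X.hom = p) (f : A ⟶ Y.left) (hf : f ≫ Y.hom = p)
    (e : ∀ ⦃Z : C⦄ (a b : Z ⟶ A), a ≫ p = b ≫ p → a ≫ f = b ≫ f) :
    ∃ φ : X ⟶ Y, s ≫ φ.left = f := by
  have hX := isPullback_proj p X
  have hY := isPullback_proj p Y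
  have hX' : proj p X = ((Γ.pullbackFunctor p).obj X).hom ≫ s := by
    rw [← cancel_mono X.hom, (isPullback_proj p X).w, Category.assoc, hs]
  let k : (Γ.pullbackFunctor p).obj X ⟶ (Γ.pullbackFunctor p).obj Y :=
    MorphismProperty.Over.homMk (hY.lift (((Γ.pullbackFunctor p).obj X).hom ≫ f)
      ((Γ.pullbackFunctor p).obj X).hom (by rw [Category.assoc, hf])) (hY.lift_snd _ _ _) trivial
  have hk' : k.left ≫ proj p Y = ((Γ.pullbackFunctor p).obj X).hom ≫ f := hY.lift_fst _ _ _
  obtain ⟨φ, hφ⟩ := hp.exists_hom k (fun Z a b hab ↦ by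
    rw [hk', ← Category.assoc, ← Category.assoc]
    refine e _ _ ?_
    rw [Category.assoc, Category.assoc, ← hX.w, reassoc_of% hab])
  refine ⟨φ, ?_⟩
  have hs' : s ≫ X.hom = 𝟙 A ≫ p := hs.trans (Category.id_comp _).symm
  have h2 := hX.lift_fst s (𝟙 A) hs'
  rw [← h2, Category.assoc, hφ, hk', ← Category.assoc, hX.lift_snd]
  exact Category.id_comp f

/-- Under (M), a morphism `p` in `E` is the coequalizer of its kernel pair, relatively to the
morphisms in `E`. -/
theorem CondM.exists_factor (hM : Γ.CondM) (hp : Γ.E p) {D B' K : C} {d : D ⟶ B'}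
    (hd : Γ.E d) {b : B ⟶ B'} {f : A ⟶ D} (h : f ≫ d = p ≫ b) {k₁ k₂ : K ⟶ A}
    (hk : IsPullback k₁ k₂ p p) (e : k₁ ≫ f = k₂ ≫ f) :
    ∃ r : B ⟶ D, p ≫ r = f ∧ r ≫ d = b := by
  have := Γ.hasPullback d b hd
  let X : Γ.Slice B := MorphismProperty.Over.mk ⊤ (𝟙 B) (Γ.E.id_mem B)
  let Y : Γ.Slice B := MorphismProperty.Over.mk ⊤ (pullback.snd d b) (Γ.E.pullback_snd _ _ hd)
  have hX : IsIso X.hom := inferInstanceAs (IsIso (𝟙 B))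
  obtain ⟨φ, hφ⟩ := (hM p hp).exists_factor (X := X) (Y := Y) p (Category.comp_id p)
    (pullback.lift f p h) (pullback.lift_snd _ _ _) (fun Z x y hxy ↦ by
      change x ≫ pullback.lift f p h = y ≫ pullback.lift f p h
      apply pullback.hom_ext
      · rw [Category.assoc, Category.assoc, pullback.lift_fst, ← hk.lift_fst _ _ hxy,
          Category.assoc, e, hk.lift_snd_assoc]
      · rw [Category.assoc, Category.assoc, pullback.lift_snd, hxy])
  let r : B ⟶ pullback d b := φ.left
  have hr : r ≫ pullback.snd d b = 𝟙 B := w φ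
  have hr' : p ≫ r = pullback.lift f p h := hφ
  refine ⟨r ≫ pullback.fst d b, ?_, ?_⟩
  · rw [reassoc_of% hr', pullback.lift_fst]
  · rw [Category.assoc, pullback.condition, reassoc_of% hr]

/-- A morphism of `(C ↓ B)` whose underlying morphism is in `E` is an epimorphism. -/
theorem CondM.epi_of_left (hM : Γ.CondM) {X Y : Γ.Slice B} (φ : X ⟶ Y) (hφ : Γ.E φ.left) :
    Epi φ :=
  ⟨fun {Z} g h e ↦ by
    ext
    exact hM.cancel hφ Z.prop ((w g).trans (w h).symm) (congrArg (fun k ↦ k.left) e)⟩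

/-- On generalized elements, `hm` says that `t` carries the canonical action on the pullback of `X`
to `m`. The algebra laws for `T` are then inherited, because morphisms in `E` are epimorphisms in
slices. -/
theorem CondM.exists_desc (hM : Γ.CondM) (hp : Γ.E p) {X : Γ.Slice B}
    {T : Γ.Slice A} (t : (Γ.pullbackFunctor p).obj X ⟶ T) (ht : Γ.E t.left)
    (m : (Γ.pullbackFunctor p).obj ((map hp).obj T) ⟶ T)
    (hm : ∀ ⦃Z : C⦄ (a b : Z ⟶ ((Γ.pullbackFunctor p).obj X).left)
      (c : Z ⟶ ((Γ.pullbackFunctor p).obj ((map hp).obj T)).left),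
      a ≫ proj p X = b ≫ proj p X → c ≫ proj p _ = a ≫ t.left →
      c ≫ ((Γ.pullbackFunctor p).obj ((map hp).obj T)).hom =
        b ≫ ((Γ.pullbackFunctor p).obj X).hom → c ≫ m.left = b ≫ t.left) :
    ∃ (Y : Γ.Slice B) (φ : X ⟶ Y) (τ : T.left ⟶ Y.left),
      IsPullback τ T.hom Y.hom p ∧ t.left ≫ τ = proj p X ≫ φ.left := by
  obtain ⟨-, ⟨_⟩⟩ := hM p hp
  -- The monad preserves morphisms lying in `E`, since its value at `k` is a pullback of `k`.
  -- Applied twice to `t`, this yields the epimorphism needed for associativity.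
  have h {U V : Γ.Slice A} (k : U ⟶ V) (hk : Γ.E k.left) :
      Γ.E ((Γ.pullbackFunctor p).map ((map hp).map k)).left := by
    have h1 := isPullback_proj p ((map hp).obj U)
    have h2 := isPullback_proj p ((map hp).obj V)
    have h3 : IsPullback ((Γ.pullbackFunctor p).map ((map hp).map k)).left (proj p _)
        (proj p _) ((map hp).map k).left := by
      refine IsPullback.of_right (h₁₂ := ((Γ.pullbackFunctor p).obj ((map hp).obj V)).hom)
        (v₁₃ := p) (h₂₂ := ((map hp).obj V).hom) ?_ (map_left_proj p ((map hp).map k)) h2.flip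
      rw [w, w]
      exact h1.flip
    exact Γ.E.of_isPullback h3.flip hk
  have := hM.epi_of_left t ht
  have := hM.epi_of_left _ (h _ (h _ ht))
  obtain ⟨Y, φ, e, he⟩ := MonadicRightAdjoint.exists_desc (mapPullbackAdj hp) t m (by
    ext
    refine hm (proj p _)
      ((Γ.pullbackFunctor p).map ((mapPullbackAdj hp).counit.app X)).left _ ?_ ?_ ?_
    · exact (map_left_proj p ((mapPullbackAdj hp).counit.app X)).symm
    · exact map_left_proj p ((map hp).map t)
    · exact (w ((Γ.pullbackFunctor p).map ((map hp).map t))).trans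
        (w ((Γ.pullbackFunctor p).map ((mapPullbackAdj hp).counit.app X))).symm)
  have : IsIso e.hom.left := isIso_left e.hom
  have : IsIso e.inv.left := isIso_left e.inv
  have hi : e.hom.left ≫ e.inv.left = 𝟙 _ := by
    rw [← comp_left, e.hom_inv_id]; rfl
  have hi' : e.inv.left ≫ e.hom.left = 𝟙 _ := by
    rw [← comp_left, e.inv_hom_id]; rfl
  refine ⟨Y, φ, e.inv.left ≫ proj p Y, ?_, ?_⟩
  · refine (isPullback_proj p Y).of_iso ⟨e.hom.left, e.inv.left, hi, hi'⟩ (Iso.refl _)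
      (Iso.refl _) (Iso.refl _) ?_ ?_ ?_ ?_
    · simp [reassoc_of% hi]
    · exact (Category.comp_id _).trans (w e.hom).symm
    · simp
    · simp
  · rw [← map_left_proj, ← he, comp_left, Category.assoc, reassoc_of% hi]

/-- Descent of a quotient of a kernel pair along a morphism `f` in `E`. -/
theorem CondM.exists_quotient (hM : Γ.CondM) {f : A ⟶ B} (hf : Γ.E f) {R T N : C} {π₁ π₂ : R ⟶ A}
    (hR : IsPullback π₂ π₁ f f) {τ : T ⟶ A} (hτ : Γ.E τ) {t : R ⟶ T} (ht : Γ.E t)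
    (htτ : t ≫ τ = π₁) {n₁ : N ⟶ T} {n₂ : N ⟶ A} (hN : IsPullback n₁ n₂ (τ ≫ f) f) (m : N ⟶ T)
    (hmτ : m ≫ τ = n₂) (hm : ∀ ⦃Z : C⦄ (r r' : Z ⟶ R) (c : Z ⟶ N), r ≫ π₂ = r' ≫ π₂ →
      c ≫ n₁ = r ≫ t → c ≫ n₂ = r' ≫ π₁ → c ≫ m = r' ≫ t) :
    ∃ (A' : C) (a' : A' ⟶ B) (q : A ⟶ A') (τ' : T ⟶ A'), Γ.E a' ∧ q ≫ a' = f ∧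
      IsPullback τ' τ a' f ∧ t ≫ τ' = π₂ ≫ q := by
  let X : Γ.Slice B := MorphismProperty.Over.mk ⊤ f hf
  let U : Γ.Slice A := MorphismProperty.Over.mk ⊤ τ hτ
  have hX : IsPullback (proj f X) ((Γ.pullbackFunctor f).obj X).hom f f := isPullback_proj f X
  have hU : IsPullback (proj f ((map hf).obj U)) ((Γ.pullbackFunctor f).obj ((map hf).obj U)).hom
    (τ ≫ f) f := isPullback_proj f ((map hf).obj U)
  let i := hX.isoIsPullback _ _ hR
  let j := hU.isoIsPullback _ _ hN
  have hi₁ : i.hom ≫ π₂ = proj f X := hX.isoIsPullback_hom_fst _ _ hR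
  have hi₂ : i.hom ≫ π₁ = ((Γ.pullbackFunctor f).obj X).hom := hX.isoIsPullback_hom_snd _ _ hR
  have hj₁ : j.hom ≫ n₁ = proj f ((map hf).obj U) := hU.isoIsPullback_hom_fst _ _ hN
  have hj₂ : j.hom ≫ n₂ = ((Γ.pullbackFunctor f).obj ((map hf).obj U)).hom :=
    hU.isoIsPullback_hom_snd _ _ hN
  let t' : (Γ.pullbackFunctor f).obj X ⟶ U := MorphismProperty.Over.homMk (i.hom ≫ t)
    ((Category.assoc _ _ _).trans ((congrArg (i.hom ≫ ·) htτ).trans hi₂)) trivial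
  let m' : (Γ.pullbackFunctor f).obj ((map hf).obj U) ⟶ U :=
    MorphismProperty.Over.homMk (j.hom ≫ m)
      ((Category.assoc _ _ _).trans ((congrArg (j.hom ≫ ·) hmτ).trans hj₂)) trivial
  obtain ⟨Y, φ, σ, hσ, e⟩ := hM.exists_desc hf t'
    (Γ.E.comp_mem _ _ (Γ.iso_mem i.hom inferInstance) ht) m' (fun Z a b c h₁ h₂ h₃ ↦ by
      have key := hm (a ≫ i.hom) (b ≫ i.hom) (c ≫ j.hom)
        ((Category.assoc _ _ _).trans ((congrArg (a ≫ ·) hi₁).trans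
          (h₁.trans ((Category.assoc _ _ _).trans (congrArg (b ≫ ·) hi₁)).symm)))
        ((Category.assoc _ _ _).trans ((congrArg (c ≫ ·) hj₁).trans
          (h₂.trans (Category.assoc _ _ _).symm)))
        (by rw [Category.assoc, Category.assoc, hj₂, hi₂, h₃])
      rw [Category.assoc, Category.assoc] at key
      exact key)
  let φ' : A ⟶ Y.left := φ.left
  let σ' : T ⟶ Y.left := σ
  refine ⟨Y.left, Y.hom, φ', σ', Y.prop, w φ, hσ, (cancel_epi i.hom).1 ?_⟩
  have e' : i.hom ≫ t ≫ σ' = (i.hom ≫ π₂) ≫ φ' := by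
    rw [hi₁]
    exact (Category.assoc _ _ _).symm.trans e
  rw [e', Category.assoc]

end GaloisStructure

/-! ### Componentwise pullbacks of arrows -/

variable {C : Type u} [Category.{v} C]

theorem CategoryTheory.Arrow.isPullback {a b c d : Arrow C} {f : a ⟶ b} {g : a ⟶ c} {h : b ⟶ d}
    {k : c ⟶ d} (hl : IsPullback f.left g.left h.left k.left)
    (hr : IsPullback f.right g.right h.right k.right) : IsPullback f g h k := by
  refine .mk' (by ext; exacts [hl.w, hr.w]) (fun Z φ φ' e e' ↦ ?_) (fun Z u v w ↦ ?_)
  · ext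
    · exact hl.hom_ext (congrArg CommaMorphism.left e) (congrArg CommaMorphism.left e')
    · exact hr.hom_ext (congrArg CommaMorphism.right e) (congrArg CommaMorphism.right e')
  · have wl : u.left ≫ h.left = v.left ≫ k.left := congrArg CommaMorphism.left w
    have wr : u.right ≫ h.right = v.right ≫ k.right := congrArg CommaMorphism.right w
    refine ⟨Arrow.homMk (hl.lift _ _ wl) (hr.lift _ _ wr) ?_, ?_, ?_⟩
    · apply hr.hom_ext
      · simp [← Arrow.w]
      · simp [← Arrow.w]
    · ext
      · exact hl.lift_fst _ _ _
      · exact hr.lift_fst _ _ _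
    · ext
      · exact hl.lift_snd _ _ _
      · exact hr.lift_snd _ _ _

variable {E : MorphismProperty C}

namespace ExtCat

theorem isPullback {a b c d : ExtCat E} {f : a ⟶ b} {g : a ⟶ c} {h : b ⟶ d}
    {k : c ⟶ d} (hl : IsPullback f.hom.left g.hom.left h.hom.left k.hom.left)
    (hr : IsPullback f.hom.right g.hom.right h.hom.right k.hom.right) : IsPullback f g h k :=
  IsPullback.of_map_of_faithful (incl E) (Arrow.isPullback hl hr)

end ExtCat

/-! ### The class `E¹` in terms of comparison morphisms -/

section

variable [E.HasPullbacks]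

/-- A pullback of a morphism in `E¹` is computed componentwise. -/
theorem extClass.isPullback {a b c d : ExtCat E} {f : d ⟶ a} {g : d ⟶ c} {φ : a ⟶ b}
    {ψ : c ⟶ b} (hφ : extClass E φ) (h : IsPullback f g φ ψ) :
    IsPullback f.hom.left g.hom.left φ.hom.left ψ.hom.left ∧
      IsPullback f.hom.right g.hom.right φ.hom.right ψ.hom.right := by
  have : HasPullback φ.hom.left ψ.hom.left := MorphismProperty.hasPullback _ hφ.1
  have : HasPullback φ.hom.right ψ.hom.right := MorphismProperty.hasPullback _ hφ.2.1
  have hL := IsPullback.of_hasPullback φ.hom.left ψ.hom.left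
  have hR := IsPullback.of_hasPullback φ.hom.right ψ.hom.right
  let k : pullback φ.hom.left ψ.hom.left ⟶ pullback φ.hom.right ψ.hom.right :=
    hR.lift (pullback.fst _ _ ≫ a.obj.hom) (pullback.snd _ _ ≫ c.obj.hom) (by
      rw [Category.assoc, Category.assoc, ← Arrow.w, ← Arrow.w, pullback.condition_assoc])
  let fst : Arrow.mk k ⟶ a.obj := Arrow.homMk _ _ (hR.lift_fst _ _ _).symm
  let snd : Arrow.mk k ⟶ c.obj := Arrow.homMk _ _ (hR.lift_snd _ _ _).symm
  have hk : IsPullback fst snd φ.hom ψ.hom := Arrow.isPullback hL hR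
  have := (hφ.2.2 ψ).2
  have h' : IsPullback f.hom g.hom φ.hom ψ.hom := h.map (ExtCat.incl E)
  let i := h'.isoIsPullback _ _ hk
  have hi₁ : i.inv ≫ f.hom = fst := h'.isoIsPullback_inv_fst _ _ hk
  have hi₂ : i.inv ≫ g.hom = snd := h'.isoIsPullback_inv_snd _ _ hk
  constructor
  · exact hL.of_iso (Arrow.leftFunc.mapIso i).symm (Iso.refl _) (Iso.refl _) (Iso.refl _)
      ((Category.comp_id _).trans (congrArg CommaMorphism.left hi₁).symm)
      ((Category.comp_id _).trans (congrArg CommaMorphism.left hi₂).symm) (by simp) (by simp)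
  · exact hR.of_iso (Arrow.rightFunc.mapIso i).symm (Iso.refl _) (Iso.refl _) (Iso.refl _)
      ((Category.comp_id _).trans (congrArg CommaMorphism.right hi₁).symm)
      ((Category.comp_id _).trans (congrArg CommaMorphism.right hi₂).symm) (by simp) (by simp)

variable [E.IsStableUnderBaseChange] [E.IsMultiplicative]

/-- If the comparison of a commutative square with a pullback is in `E`, so is the morphism
obtained by pulling back this square along a morphism of arrows in `E`. -/
theorem CategoryTheory.MorphismProperty.mem_of_isPullback_of_comparison
    {A₁ A₀ B₁ B₀ C₁ C₀ P L R : C} {a : A₁ ⟶ A₀} {b : B₁ ⟶ B₀} {c : C₁ ⟶ C₀}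
    {f₁ : A₁ ⟶ B₁} {f₀ : A₀ ⟶ B₀} {g₁ : C₁ ⟶ B₁} {g₀ : C₀ ⟶ B₀}
    (hf₀ : E f₀) (hc : E c) (hg : g₁ ≫ b = c ≫ g₀)
    {p₀ : P ⟶ A₀} {p₁ : P ⟶ B₁} (hP : IsPullback p₀ p₁ f₀ b)
    {e : A₁ ⟶ P} (he : E e) (he₀ : e ≫ p₀ = a) (he₁ : e ≫ p₁ = f₁)
    {l₁ : L ⟶ A₁} {l₂ : L ⟶ C₁} (hL : IsPullback l₁ l₂ f₁ g₁)
    {r₁ : R ⟶ A₀} {r₂ : R ⟶ C₀} (hR : IsPullback r₁ r₂ f₀ g₀)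
    {k : L ⟶ R} (hk₁ : k ≫ r₁ = l₁ ≫ a) (hk₂ : k ≫ r₂ = l₂ ≫ c) : E k := by
  have hp₁ : E p₁ := E.of_isPullback hP hf₀
  have : HasPullback p₁ g₁ := MorphismProperty.HasPullbacks.hasPullback g₁ hp₁
  have hQ := IsPullback.of_hasPullback p₁ g₁
  set x := pullback.fst p₁ g₁
  set y := pullback.snd p₁ g₁
  -- `k` factors as `s ≫ z`, with `s` a pullback of `e` and `z` a pullback of `c`.
  let s : L ⟶ pullback p₁ g₁ := hQ.lift (l₁ ≫ e) l₂ (by rw [Category.assoc, he₁, hL.w])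
  have hs₁ : s ≫ x = l₁ ≫ e := hQ.lift_fst _ _ _
  have hs₂ : s ≫ y = l₂ := hQ.lift_snd _ _ _
  have hs : IsPullback s l₁ x e := by
    refine IsPullback.of_right (h₁₂ := y) (h₂₂ := p₁) (v₁₃ := g₁) ?_ hs₁ hQ.flip
    rw [hs₂, he₁]
    exact hL.flip
  let z : pullback p₁ g₁ ⟶ R := hR.lift (x ≫ p₀) (y ≫ c) (by
    rw [Category.assoc, hP.w, hQ.w_assoc, hg, Category.assoc])
  have hz₁ : z ≫ r₁ = x ≫ p₀ := hR.lift_fst _ _ _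
  have hz₂ : z ≫ r₂ = y ≫ c := hR.lift_snd _ _ _
  have hz : IsPullback z y r₂ c := by
    refine IsPullback.of_right ?_ hz₂ hR
    rw [hz₁, ← hg]
    exact hQ.paste_horiz hP
  have : s ≫ z = k := by
    apply hR.hom_ext
    · rw [Category.assoc, hz₁, reassoc_of% hs₁, he₀, hk₁]
    · rw [Category.assoc, hz₂, reassoc_of% hs₂, hk₂]
  rw [← this]
  exact E.comp_mem _ _ (E.of_isPullback hs.flip he) (E.of_isPullback hz.flip hc)

/-- The morphism between kernel pairs induced by a commutative square whose comparison is in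
`E`. -/
theorem CategoryTheory.MorphismProperty.mem_of_isPullback_kernelPair
    {A₁ A₀ B₁ B₀ P L R : C} {a : A₁ ⟶ A₀} {b : B₁ ⟶ B₀}
    {f₁ : A₁ ⟶ B₁} {f₀ : A₀ ⟶ B₀} (hf₁ : E f₁) (hb : E b) (w : a ≫ f₀ = f₁ ≫ b)
    {p₀ : P ⟶ A₀} {p₁ : P ⟶ B₁} (hP : IsPullback p₀ p₁ f₀ b)
    {e : A₁ ⟶ P} (he : E e) (he₀ : e ≫ p₀ = a) (he₁ : e ≫ p₁ = f₁)
    {l₁ l₂ : L ⟶ A₁} (hL : IsPullback l₁ l₂ a a)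
    {r₁ r₂ : R ⟶ B₁} (hR : IsPullback r₁ r₂ b b)
    {k : L ⟶ R} (hk₁ : k ≫ r₁ = l₁ ≫ f₁) (hk₂ : k ≫ r₂ = l₂ ≫ f₁) : E k :=
  MorphismProperty.mem_of_isPullback_of_comparison (a := f₁) (b := f₀) (c := f₁) (f₁ := a)
    (f₀ := b) (g₁ := a) (g₀ := b) hb hf₁ w hP.flip he he₁ he₀ hL hR hk₁ hk₂

/-- A square whose sides and comparison are in `E` belongs to `E¹`. -/
theorem extClass_of_comparison {a b : ExtCat E} (φ : a ⟶ b) (h₁ : E φ.hom.left)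
    (h₀ : E φ.hom.right) {P : C} {p₀ : P ⟶ a.obj.right} {p₁ : P ⟶ b.obj.left}
    (hP : IsPullback p₀ p₁ φ.hom.right b.obj.hom) {e : a.obj.left ⟶ P} (he : E e)
    (he₀ : e ≫ p₀ = a.obj.hom) (he₁ : e ≫ p₁ = φ.hom.left) : extClass E φ := by
  refine ⟨h₁, h₀, fun c ψ ↦ ?_⟩
  have : HasPullback φ.hom.left ψ.hom.left := MorphismProperty.hasPullback _ h₁
  have : HasPullback φ.hom.right ψ.hom.right := MorphismProperty.hasPullback _ h₀
  have hL := IsPullback.of_hasPullback φ.hom.left ψ.hom.left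
  have hR := IsPullback.of_hasPullback φ.hom.right ψ.hom.right
  let k : pullback φ.hom.left ψ.hom.left ⟶ pullback φ.hom.right ψ.hom.right :=
    hR.lift (pullback.fst _ _ ≫ a.obj.hom) (pullback.snd _ _ ≫ c.obj.hom) (by
      rw [Category.assoc, Category.assoc, ← Arrow.w, ← Arrow.w, pullback.condition_assoc])
  have hk₁ : k ≫ pullback.fst _ _ = pullback.fst _ _ ≫ a.obj.hom := hR.lift_fst _ _ _
  have hk₂ : k ≫ pullback.snd _ _ = pullback.snd _ _ ≫ c.obj.hom := hR.lift_snd _ _ _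
  have hk : E k := MorphismProperty.mem_of_isPullback_of_comparison h₀ c.property
    (Arrow.w ψ.hom) hP he he₀ he₁ hL hR hk₁ hk₂
  let fst : ExtCat.mk k hk ⟶ a := ObjectProperty.homMk (Arrow.homMk _ _ hk₁.symm)
  let snd : ExtCat.mk k hk ⟶ c := ObjectProperty.homMk (Arrow.homMk _ _ hk₂.symm)
  have h : IsPullback fst snd φ ψ := ExtCat.isPullback hL hR
  exact ⟨h.hasPullback, h.preservesLimit_cospan_iff.2 (Arrow.isPullback hL hR)⟩

/-- The comparison of a square in `E¹` is in `E`. -/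
theorem extClass.comparison {a b : ExtCat E} {φ : a ⟶ b} (hφ : extClass E φ) {P : C}
    {p₀ : P ⟶ a.obj.right} {p₁ : P ⟶ b.obj.left}
    (hP : IsPullback p₀ p₁ φ.hom.right b.obj.hom) {e : a.obj.left ⟶ P}
    (he₀ : e ≫ p₀ = a.obj.hom) (he₁ : e ≫ p₁ = φ.hom.left) : E e := by
  -- The pullback of `φ` along this `ψ` is `e` up to isomorphism; being an object of `Ext(C)`, it is
  -- in `E`.
  let c : ExtCat E := ExtCat.mk (𝟙 b.obj.left) (E.id_mem _)
  let ψ : c ⟶ b := ObjectProperty.homMk (Arrow.homMk (𝟙 _) b.obj.hom)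
  have := (hφ.2.2 ψ).1
  obtain ⟨hL, hR⟩ := hφ.isPullback (IsPullback.of_hasPullback φ ψ)
  have hl : IsIso (pullback.fst φ ψ).hom.left :=
    hL.isIso_fst_of_isIso (inferInstanceAs (IsIso (𝟙 _)))
  let i := hR.isoIsPullback _ _ hP
  have hi₁ : i.hom ≫ p₀ = _ := hR.isoIsPullback_hom_fst _ _ hP
  have hi₂ : i.hom ≫ p₁ = _ := hR.isoIsPullback_hom_snd _ _ hP
  have : (pullback.fst φ ψ).hom.left ≫ e = (pullback φ ψ).obj.hom ≫ i.hom := by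
    apply hP.hom_ext
    · rw [Category.assoc, Category.assoc, he₀, hi₁, Arrow.w]
    · rw [Category.assoc, Category.assoc, he₁, hi₂, hL.w, ← Arrow.w]
      simp [ψ, c]
  refine (E.cancel_left_of_respectsIso (pullback.fst φ ψ).hom.left e).1 ?_
  rw [this]
  exact (E.cancel_right_of_respectsIso _ _).2 (pullback φ ψ).property

/-- A morphism of `Ext(C)` belongs to `E¹` if its domain component is in `E` and its codomain
component is invertible. -/
theorem extClass_of_isIso_right {a b : ExtCat E} (φ : a ⟶ b) (h₁ : E φ.hom.left)
    (h₀ : IsIso φ.hom.right) : extClass E φ :=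
  extClass_of_comparison φ h₁ (E.of_isIso _) (p₀ := b.obj.hom ≫ inv φ.hom.right) (p₁ := 𝟙 _)
    (IsPullback.of_vert_isIso ⟨by simp⟩) h₁ (by simp) (by simp)

/-- The comparison of a composite is that of `φ` followed by a pullback of that of `ψ`. -/
instance : (extClass E).IsMultiplicative where
  id_mem a := extClass_of_isIso_right (𝟙 a) (E.id_mem _) (inferInstanceAs (IsIso (𝟙 _)))
  comp_mem {a b c} φ ψ hφ hψ := by
    have : HasPullback φ.hom.right b.obj.hom := MorphismProperty.hasPullback _ hφ.2.1
    have : HasPullback ψ.hom.right c.obj.hom := MorphismProperty.hasPullback _ hψ.2.1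
    have : HasPullback φ.hom.right (pullback.fst ψ.hom.right c.obj.hom) :=
      MorphismProperty.hasPullback _ hφ.2.1
    have hP := IsPullback.of_hasPullback φ.hom.right b.obj.hom
    have hR := IsPullback.of_hasPullback ψ.hom.right c.obj.hom
    have hQ := IsPullback.of_hasPullback φ.hom.right (pullback.fst ψ.hom.right c.obj.hom)
    let e := hP.lift a.obj.hom φ.hom.left (Arrow.w φ.hom).symm
    let e' := hR.lift b.obj.hom ψ.hom.left (Arrow.w ψ.hom).symm
    have he₀ : e ≫ pullback.fst _ _ = a.obj.hom := hP.lift_fst _ _ _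
    have he₁ : e ≫ pullback.snd _ _ = φ.hom.left := hP.lift_snd _ _ _
    have he₀' : e' ≫ pullback.fst _ _ = b.obj.hom := hR.lift_fst _ _ _
    have he₁' : e' ≫ pullback.snd _ _ = ψ.hom.left := hR.lift_snd _ _ _
    let s := hQ.lift (pullback.fst φ.hom.right b.obj.hom) (pullback.snd _ _ ≫ e')
      (by rw [Category.assoc, he₀', hP.w])
    have hs₀ : s ≫ pullback.fst _ _ = pullback.fst _ _ := hQ.lift_fst _ _ _
    have hs₁ : s ≫ pullback.snd _ _ = pullback.snd _ _ ≫ e' := hQ.lift_snd _ _ _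
    have hs : IsPullback s (pullback.snd _ _) (pullback.snd _ _) e' := by
      refine IsPullback.of_right ?_ hs₁ hQ
      rw [hs₀, he₀']
      exact hP
    refine extClass_of_comparison (φ ≫ ψ) (E.comp_mem _ _ hφ.1 hψ.1)
      (E.comp_mem _ _ hφ.2.1 hψ.2.1) (hQ.flip.paste_horiz hR.flip).flip (e := e ≫ s)
      (E.comp_mem _ _ (hφ.comparison hP he₀ he₁)
        (E.of_isPullback hs.flip (hψ.comparison hR he₀' he₁'))) ?_ ?_
    · rw [Category.assoc, hs₀, he₀]
    · rw [Category.assoc, reassoc_of% hs₁, he₁', reassoc_of% he₁]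
      rfl

/-- The comparison of the pulled-back square is a pullback of the comparison of `φ`. -/
instance : (extClass E).IsStableUnderBaseChange where
  of_isPullback {c a d b} ψ φ f g h hφ := by
    obtain ⟨hl, hr⟩ := hφ.isPullback h
    have hg : E g.hom.right := E.of_isPullback hr hφ.2.1
    have : HasPullback φ.hom.right b.obj.hom := MorphismProperty.hasPullback _ hφ.2.1
    have : HasPullback g.hom.right c.obj.hom := MorphismProperty.hasPullback _ hg
    have hP := IsPullback.of_hasPullback φ.hom.right b.obj.hom
    have hQ := IsPullback.of_hasPullback g.hom.right c.obj.hom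
    let e := hP.lift a.obj.hom φ.hom.left (Arrow.w φ.hom).symm
    let e' := hQ.lift d.obj.hom g.hom.left (Arrow.w g.hom).symm
    have he₀ : e ≫ pullback.fst _ _ = a.obj.hom := hP.lift_fst _ _ _
    have he₁ : e ≫ pullback.snd _ _ = φ.hom.left := hP.lift_snd _ _ _
    have he₀' : e' ≫ pullback.fst _ _ = d.obj.hom := hQ.lift_fst _ _ _
    have he₁' : e' ≫ pullback.snd _ _ = g.hom.left := hQ.lift_snd _ _ _
    let s := hP.lift (pullback.fst g.hom.right c.obj.hom ≫ f.hom.right)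
      (pullback.snd _ _ ≫ ψ.hom.left)
      (by rw [Category.assoc, hr.w, hQ.w_assoc, Category.assoc, Arrow.w])
    have hs₀ : s ≫ pullback.fst _ _ = pullback.fst _ _ ≫ f.hom.right := hP.lift_fst _ _ _
    have hs₁ : s ≫ pullback.snd _ _ = pullback.snd _ _ ≫ ψ.hom.left := hP.lift_snd _ _ _
    have hs : IsPullback s (pullback.snd _ _) (pullback.snd _ _) ψ.hom.left := by
      refine IsPullback.of_right ?_ hs₁ hP
      rw [hs₀, Arrow.w]
      exact hQ.paste_horiz hr
    have he : IsPullback e' f.hom.left s e := by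
      refine IsPullback.of_right ?_ ?_ hs.flip
      · rw [he₁', he₁]
        exact hl.flip
      · apply hP.hom_ext
        · rw [Category.assoc, Category.assoc, hs₀, reassoc_of% he₀', he₀, Arrow.w]
        · rw [Category.assoc, Category.assoc, hs₁, reassoc_of% he₁', he₁, hl.w]
    exact extClass_of_comparison g (E.of_isPullback hl hφ.1) hg hQ
      (E.of_isPullback he.flip (hφ.comparison hP he₀ he₁)) he₀' he₁'

end

/-! ### Trivial coverings, and pullbacks preserved by the reflection -/

variable {C : Type u} [Category.{v} C]

/-- A commutative square of split epimorphisms with two parallel sides in `E` has its comparison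
in `E`. -/
theorem CondE5.comparison {E : MorphismProperty C} [E.HasPullbacks] [E.IsStableUnderBaseChange]
    [E.IsMultiplicative] (h5 : CondE5 E) {A₁ A₀ B₁ B₀ P : C} {a : A₁ ⟶ A₀} {b : B₁ ⟶ B₀}
    {f₁ : A₁ ⟶ B₁} {f₀ : A₀ ⟶ B₀} {s₁ : B₁ ⟶ A₁} {s₀ : B₀ ⟶ A₀} (ha : E a) (hb : E b)
    (w : f₁ ≫ b = a ≫ f₀) (ws : s₁ ≫ a = b ≫ s₀) (h₁ : s₁ ≫ f₁ = 𝟙 B₁) (h₀ : s₀ ≫ f₀ = 𝟙 B₀)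
    {p₀ : P ⟶ A₀} {p₁ : P ⟶ B₁} (hP : IsPullback p₀ p₁ f₀ b) {e : A₁ ⟶ P}
    (he₀ : e ≫ p₀ = a) (he₁ : e ≫ p₁ = f₁) : E e := by
  have h : ExtCat.homMk hb ha s₁ s₀ ws ≫ ExtCat.homMk ha hb f₁ f₀ w = 𝟙 _ := by
    ext
    · exact h₁
    · exact h₀
  exact (h5 _ _ h).comparison (φ := ExtCat.homMk ha hb f₁ f₀ w) hP he₀ he₁

namespace GaloisStructure

variable {Γ : GaloisStructure C}

instance hasPullbacks (Γ : GaloisStructure C) : Γ.E.HasPullbacks where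
  hasPullback g hf := Γ.hasPullback _ g hf

theorem exists_isPullback {A B D : C} {f : A ⟶ B} (hf : Γ.E f) (g : D ⟶ B) :
    ∃ (P : C) (p : P ⟶ A) (q : P ⟶ D), IsPullback p q f g :=
  have := Γ.hasPullback f g hf
  ⟨_, _, _, IsPullback.of_hasPullback f g⟩

/-- The component of the reflection unit at an object. -/
def unit (Γ : GaloisStructure C) (A : C) : A ⟶ Γ.HI.obj A := Γ.η.app A

theorem unit_naturality {A B : C} (f : A ⟶ B) : f ≫ Γ.unit B = Γ.unit A ≫ Γ.HI.map f :=
  Γ.η.naturality f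

/-- Factorization of a morphism to an object of the subcategory through the unit. -/
theorem exists_unit_comp_eq {A X : C} (hX : Γ.X X) (f : A ⟶ X) :
    ∃ g : Γ.HI.obj A ⟶ X, Γ.unit A ≫ g = f := by
  refine ⟨(((Γ.adj.homEquiv A ⟨X, hX⟩).symm f).hom), ?_⟩
  exact ((Γ.adj.homEquiv_unit _ _ _).symm.trans ((Γ.adj.homEquiv A ⟨X, hX⟩).apply_symm_apply f))

variable {A B : C} {f : A ⟶ B}

theorem CondB.unit_mem (hB : Γ.CondB) (A : C) : Γ.E (Γ.unit A) :=
  (hB (𝟙 A) (Γ.E.id_mem A)).1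

theorem CondB.comparison (hB : Γ.CondB) (hf : Γ.E f) {P : C} {p : P ⟶ B} {q : P ⟶ Γ.HI.obj A}
    (hP : IsPullback p q (Γ.unit B) (Γ.HI.map f)) {e : A ⟶ P} (h₁ : e ≫ p = f)
    (h₂ : e ≫ q = Γ.unit A) : Γ.E e :=
  (hB f hf).comparison (φ := Γ.unitSquare f hf) hP h₁ h₂

/-- Trivial coverings are the morphisms in `E` that are jointly monic with the unit. -/
theorem isTrivialCovering_of_hom_ext (hM : Γ.CondM) (hB : Γ.CondB) (hf : Γ.E f)
    (h : ∀ ⦃Z : C⦄ (u v : Z ⟶ A), u ≫ f = v ≫ f → u ≫ Γ.unit A = v ≫ Γ.unit A → u = v) :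
    Γ.IsTrivialCovering f := by
  obtain ⟨P, p, q, hP⟩ := exists_isPullback (hB.unit_mem B) (Γ.HI.map f)
  let e : A ⟶ P := hP.lift f (Γ.unit A) (unit_naturality f)
  have h₁ : e ≫ p = f := hP.lift_fst _ _ _
  have h₂ : e ≫ q = Γ.unit A := hP.lift_snd _ _ _
  -- Joint monicity of `f` and the unit is monicity of this comparison, which (M) then makes
  -- invertible.
  have he : Γ.E e := hB.comparison hf hP h₁ h₂
  have : Mono e := ⟨fun u v w ↦ h u v (by rw [← h₁, reassoc_of% w]) (by rw [← h₂, reassoc_of% w])⟩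
  have := hM.isIso he
  refine ⟨hf, ?_⟩
  exact hP.flip.of_iso (asIso e).symm (Iso.refl _) (Iso.refl _) (Iso.refl _)
    ((Category.comp_id _).trans ((IsIso.eq_inv_comp e).2 h₂))
    ((Category.comp_id _).trans ((IsIso.eq_inv_comp e).2 h₁)) (by simp) (by simp [unit])

theorem IsTrivialCovering.hom_ext (hf : Γ.IsTrivialCovering f) {Z : C} {u v : Z ⟶ A}
    (h₁ : u ≫ f = v ≫ f) (h₂ : u ≫ Γ.unit A = v ≫ Γ.unit A) : u = v :=
  hf.2.hom_ext h₂ h₁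

theorem IsTrivialCovering.of_isPullback (hM : Γ.CondM) (hB : Γ.CondB)
    (hf : Γ.IsTrivialCovering f) {P D : C} {p : P ⟶ A} {q : P ⟶ D} {g : D ⟶ B}
    (hP : IsPullback p q f g) : Γ.IsTrivialCovering q := by
  refine isTrivialCovering_of_hom_ext hM hB (Γ.E.of_isPullback hP hf.1) (fun Z u v h₁ h₂ ↦
    hP.hom_ext (hf.hom_ext ?_ ?_) h₁)
  · rw [Category.assoc, Category.assoc, hP.w, reassoc_of% h₁]
  · rw [Category.assoc, Category.assoc, unit_naturality, reassoc_of% h₂]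

/-- The pullback of a morphism of the subcategory along the unit is a trivial covering. -/
theorem isTrivialCovering_of_isPullback_unit (hM : Γ.CondM) (hB : Γ.CondB) {P X : C}
    (hX : Γ.X X) {g : X ⟶ Γ.HI.obj B} (hg : Γ.E g) {p : P ⟶ B} {q : P ⟶ X}
    (hP : IsPullback p q (Γ.unit B) g) : Γ.IsTrivialCovering p := by
  -- Since `q` factors through the unit, joint monicity of `p` and `q` passes to `p` and the unit.
  obtain ⟨k, hk⟩ := exists_unit_comp_eq hX q
  refine isTrivialCovering_of_hom_ext hM hB (Γ.E.of_isPullback hP.flip hg) (fun Z u v h₁ h₂ ↦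
    hP.hom_ext h₁ ?_)
  rw [← hk, reassoc_of% h₂]

/-- The morphism induced between the kernel pairs of the units is in `E`. -/
theorem CondB.kernelPair_mem (hB : Γ.CondB) (hf : Γ.E f) {K L : C} {k₁ k₂ : K ⟶ A}
    (hK : IsPullback k₁ k₂ (Γ.unit A) (Γ.unit A)) {l₁ l₂ : L ⟶ B}
    (hL : IsPullback l₁ l₂ (Γ.unit B) (Γ.unit B)) {k : K ⟶ L} (h₁ : k ≫ l₁ = k₁ ≫ f)
    (h₂ : k ≫ l₂ = k₂ ≫ f) : Γ.E k := by
  obtain ⟨P, p, q, hP⟩ := exists_isPullback (hB.unit_mem B) (Γ.HI.map f)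
  exact MorphismProperty.mem_of_isPullback_kernelPair hf (hB.unit_mem B) (unit_naturality f).symm
    hP.flip (hB.comparison hf hP (hP.lift_fst _ _ (unit_naturality f)) (hP.lift_snd _ _ _))
    (hP.lift_snd _ _ _) (hP.lift_fst _ _ _) hK hL h₁ h₂

/-- The reflection preserves pullbacks of split epimorphisms in `E` along morphisms in `E`. -/
theorem isPullback_map (h5 : CondE5 Γ.E) (hM : Γ.CondM) (hB : Γ.CondB) (hf : Γ.E f) {s : B ⟶ A}
    (hs : s ≫ f = 𝟙 B) {D P : C} {p : D ⟶ B} (hp : Γ.E p) {d : P ⟶ D} {g : P ⟶ A}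
    (hP : IsPullback d g p f) :
    IsPullback (Γ.HI.map d) (Γ.HI.map g) (Γ.HI.map p) (Γ.HI.map f) := by
  have hd : Γ.E d := Γ.E.of_isPullback hP.flip hf
  have hg : Γ.E g := Γ.E.of_isPullback hP hp
  let j : D ⟶ P := hP.lift (𝟙 D) (p ≫ s) (by rw [Category.assoc, hs, Category.id_comp,
    Category.comp_id])
  have hjd : j ≫ d = 𝟙 D := hP.lift_fst _ _ _
  have hjg : j ≫ g = p ≫ s := hP.lift_snd _ _ _
  obtain ⟨X, x₁, x₂, hX⟩ := exists_isPullback (Γ.map_mem p hp) (Γ.HI.map f)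
  let k : Γ.HI.obj P ⟶ X := hX.lift (Γ.HI.map d) (Γ.HI.map g) (by
    rw [← Functor.map_comp, hP.w, Functor.map_comp])
  have hk₁ : k ≫ x₁ = Γ.HI.map d := hX.lift_fst _ _ _
  have hk₂ : k ≫ x₂ = Γ.HI.map g := hX.lift_snd _ _ _
  -- By (E5), the comparison `k` is in `E`; it remains to show that it is monic.
  have hk : Γ.E k := h5.comparison (a := Γ.HI.map g) (b := Γ.HI.map p) (f₁ := Γ.HI.map d)
    (f₀ := Γ.HI.map f) (s₁ := Γ.HI.map j) (s₀ := Γ.HI.map s) (Γ.map_mem g hg) (Γ.map_mem p hp)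
    (by rw [← Functor.map_comp, hP.w, Functor.map_comp])
    (by rw [← Functor.map_comp, hjg, Functor.map_comp])
    (by rw [← Functor.map_comp, hjd, CategoryTheory.Functor.map_id])
    (by rw [← Functor.map_comp, hs, CategoryTheory.Functor.map_id]) hX.flip hk₂ hk₁
  obtain ⟨RP, r₁, r₂, hRP⟩ := exists_isPullback (hB.unit_mem P) (Γ.unit P)
  obtain ⟨RA, a₁, a₂, hRA⟩ := exists_isPullback (hB.unit_mem A) (Γ.unit A)
  obtain ⟨RD, d₁, d₂, hRD⟩ := exists_isPullback (hB.unit_mem D) (Γ.unit D)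
  obtain ⟨RB, b₁, b₂, hRB⟩ := exists_isPullback (hB.unit_mem B) (Γ.unit B)
  have lift {U V RU RV : C} {u₁ u₂ : RU ⟶ U} (hU : IsPullback u₁ u₂ (Γ.unit U) (Γ.unit U))
      {v₁ v₂ : RV ⟶ V} (hV : IsPullback v₁ v₂ (Γ.unit V) (Γ.unit V)) (w : U ⟶ V) :
      ∃ w' : RU ⟶ RV, w' ≫ v₁ = u₁ ≫ w ∧ w' ≫ v₂ = u₂ ≫ w :=
    hV.exists_lift _ _ (by rw [Category.assoc, Category.assoc, unit_naturality, hU.w_assoc])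
  obtain ⟨uA, uA₁, uA₂⟩ := lift hRP hRA g
  obtain ⟨uD, uD₁, uD₂⟩ := lift hRP hRD d
  obtain ⟨vA, vA₁, vA₂⟩ := lift hRA hRB f
  obtain ⟨vD, vD₁, vD₂⟩ := lift hRD hRB p
  obtain ⟨sA, sA₁, sA₂⟩ := lift hRB hRA s
  obtain ⟨sP, sP₁, sP₂⟩ := lift hRD hRP j
  have huA : Γ.E uA := hB.kernelPair_mem hg hRP hRA uA₁ uA₂
  have hvD : Γ.E vD := hB.kernelPair_mem hp hRD hRB vD₁ vD₂
  obtain ⟨K, x, y, hK⟩ := exists_isPullback (Γ.E.comp_mem _ _ (hB.unit_mem P) hk) (Γ.unit P ≫ k)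
  obtain ⟨wA, wA₁, wA₂⟩ := hRA.exists_lift (x ≫ g) (y ≫ g) (by
    have := hK.w_assoc x₂
    simpa only [Category.assoc, hk₂, ← unit_naturality] using this)
  obtain ⟨wD, wD₁, wD₂⟩ := hRD.exists_lift (x ≫ d) (y ≫ d) (by
    have := hK.w_assoc x₁
    simpa only [Category.assoc, hk₁, ← unit_naturality] using this)
  -- Because `P` is a pullback, a pair in `P` with equal images in `X` is the same as a pair from
  -- `RA` and a pair from `RD` that agree in `RB`.
  have hw : IsPullback wA wD vA vD := by
    refine .mk' ?_ (fun Z φ φ' h h' ↦ ?_) (fun Z α β h ↦ ?_)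
    · apply hRB.hom_ext
      · simp only [Category.assoc, vA₁, vD₁, reassoc_of% wA₁, reassoc_of% wD₁, hP.w]
      · simp only [Category.assoc, vA₂, vD₂, reassoc_of% wA₂, reassoc_of% wD₂, hP.w]
    · apply hK.hom_ext <;> apply hP.hom_ext
      · simp only [Category.assoc, ← wD₁, reassoc_of% h']
      · simp only [Category.assoc, ← wA₁, reassoc_of% h]
      · simp only [Category.assoc, ← wD₂, reassoc_of% h']
      · simp only [Category.assoc, ← wA₂, reassoc_of% h]
    · obtain ⟨z₁, hz₁, hz₁'⟩ := hP.exists_lift (β ≫ d₁) (α ≫ a₁) (by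
        rw [Category.assoc, Category.assoc, ← vD₁, ← vA₁, reassoc_of% h])
      obtain ⟨z₂, hz₂, hz₂'⟩ := hP.exists_lift (β ≫ d₂) (α ≫ a₂) (by
        rw [Category.assoc, Category.assoc, ← vD₂, ← vA₂, reassoc_of% h])
      obtain ⟨z, hz, hz'⟩ := hK.exists_lift z₁ z₂ (by
        apply hX.hom_ext
        · simp only [Category.assoc, hk₁, ← unit_naturality]
          rw [reassoc_of% hz₁, reassoc_of% hz₂, hRD.w]
        · simp only [Category.assoc, hk₂, ← unit_naturality]
          rw [reassoc_of% hz₁', reassoc_of% hz₂', hRA.w])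
      refine ⟨z, ?_, ?_⟩
      · apply hRA.hom_ext
        · rw [Category.assoc, wA₁, reassoc_of% hz, hz₁']
        · rw [Category.assoc, wA₂, reassoc_of% hz', hz₂']
      · apply hRD.hom_ext
        · rw [Category.assoc, wD₁, reassoc_of% hz, hz₁]
        · rw [Category.assoc, wD₂, reassoc_of% hz', hz₂]
  -- `m` is the comparison of the square of kernel pairs of units, which is again split, so (E5)
  -- applies once more.
  obtain ⟨m, hm₁, hm₂⟩ := hK.exists_lift r₁ r₂ (by rw [hRP.w_assoc])
  have hm : Γ.E m := by
    refine h5.comparison (a := uA) (b := vD) (f₁ := uD) (f₀ := vA) (s₁ := sP) (s₀ := sA) huA hvD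
      ?_ ?_ ?_ ?_ hw ?_ ?_
    · apply hRB.hom_ext
      · simp only [Category.assoc, vA₁, vD₁, reassoc_of% uA₁, reassoc_of% uD₁, hP.w]
      · simp only [Category.assoc, vA₂, vD₂, reassoc_of% uA₂, reassoc_of% uD₂, hP.w]
    · apply hRA.hom_ext
      · simp only [Category.assoc, uA₁, sA₁, reassoc_of% sP₁, reassoc_of% vD₁, hjg]
      · simp only [Category.assoc, uA₂, sA₂, reassoc_of% sP₂, reassoc_of% vD₂, hjg]
    · apply hRD.hom_ext
      · simp only [Category.assoc, uD₁, reassoc_of% sP₁, hjd, Category.comp_id, Category.id_comp]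
      · simp only [Category.assoc, uD₂, reassoc_of% sP₂, hjd, Category.comp_id, Category.id_comp]
    · apply hRB.hom_ext
      · simp only [Category.assoc, vA₁, reassoc_of% sA₁, hs, Category.comp_id, Category.id_comp]
      · simp only [Category.assoc, vA₂, reassoc_of% sA₂, hs, Category.comp_id, Category.id_comp]
    · apply hRA.hom_ext
      · rw [Category.assoc, wA₁, reassoc_of% hm₁, uA₁]
      · rw [Category.assoc, wA₂, reassoc_of% hm₂, uA₂]
    · apply hRD.hom_ext
      · rw [Category.assoc, wD₁, reassoc_of% hm₁, uD₁]
      · rw [Category.assoc, wD₂, reassoc_of% hm₂, uD₂]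
  obtain ⟨L, k₁, k₂, hL⟩ := exists_isPullback hk k
  obtain ⟨n, hn₁, hn₂⟩ := hL.exists_lift (x ≫ Γ.unit P) (y ≫ Γ.unit P)
    (by rw [Category.assoc, Category.assoc, hK.w])
  have hn : Γ.E n := MorphismProperty.mem_of_isPullback_kernelPair (a := Γ.unit P ≫ k) (b := k)
    (f₀ := 𝟙 X) (hB.unit_mem P) hk (Category.comp_id _) (IsPullback.id_vert k)
    (hB.unit_mem P) rfl (Category.comp_id _) hK hL hn₁ hn₂
  -- `m ≫ n` is in `E`, and both projections of the kernel pair of `k` agree after it since the unit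
  -- of `P` identifies `r₁` and `r₂`.
  have hkk : k₁ = k₂ := hM.cancel (Γ.E.comp_mem _ _ hm hn) hk hL.w (by
    rw [Category.assoc, Category.assoc, hn₁, hn₂, reassoc_of% hm₁, reassoc_of% hm₂, hRP.w])
  have : Mono k := ⟨fun u v h ↦ by
    obtain ⟨l, hl, hl'⟩ := hL.exists_lift u v h
    rw [← hl, hkk, hl']⟩
  have := hM.isIso hk
  exact hX.of_iso (asIso k).symm (Iso.refl _) (Iso.refl _) (Iso.refl _)
    ((Category.comp_id _).trans ((IsIso.eq_inv_comp k).2 hk₁))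
    ((Category.comp_id _).trans ((IsIso.eq_inv_comp k).2 hk₂)) (by simp) (by simp)

end GaloisStructure

/-! ### Coverings and the construction of their reflection -/

namespace GaloisStructure

variable {C : Type u} [Category.{v} C] {Γ : GaloisStructure C} {A B : C} {f : A ⟶ B}

/-- Frees coverings from the chosen pullbacks: trivial coverings are invariant under isomorphism,
and (M) makes every `p` in `E` monadic. -/
theorem isCovering_of_isPullback (hM : Γ.CondM) (hB : Γ.CondB) (hf : Γ.E f) {D P : C} {p : D ⟶ B}
    (hp : Γ.E p) {x : P ⟶ A} {y : P ⟶ D} (hP : IsPullback x y f p)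
    (hy : Γ.IsTrivialCovering y) : Γ.IsCovering f := by
  let y' : ((Γ.pullbackFunctor p).obj (MorphismProperty.Over.mk ⊤ f hf)).left ⟶ D :=
    ((Γ.pullbackFunctor p).obj (MorphismProperty.Over.mk ⊤ f hf)).hom
  have h : IsPullback (Slice.proj p (MorphismProperty.Over.mk ⊤ f hf)) y' f p :=
    Slice.isPullback_proj p _
  have h' : IsPullback (h.isoIsPullback _ _ hP).hom y' y (𝟙 D) :=
    .of_horiz_isIso ⟨(h.isoIsPullback_hom_snd _ _ hP).trans (Category.comp_id _).symm⟩
  exact ⟨hf, D, p, hM p hp, hy.of_isPullback hM hB h'⟩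

theorem IsCovering.exists_split (hf : Γ.IsCovering f) :
    ∃ (D P : C) (p : D ⟶ B) (x : P ⟶ A) (y : P ⟶ D), Γ.E p ∧ IsPullback x y f p ∧
      Γ.IsTrivialCovering y := by
  obtain ⟨hf, D, p, hp, h⟩ := hf
  exact ⟨D, _, p, _, _, hp.1, Slice.isPullback_proj p _, h⟩

theorem IsCovering.mem (hf : Γ.IsCovering f) : Γ.E f := hf.1

/-- Coverings are stable under pullback. -/
theorem IsCovering.of_isPullback (hM : Γ.CondM) (hB : Γ.CondB) (hf : Γ.IsCovering f) {A' B' : C}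
    {u : A' ⟶ A} {v : A' ⟶ B'} {g : B' ⟶ B} (h : IsPullback u v f g) : Γ.IsCovering v := by
  obtain ⟨D, P, p, x, y, hp, hP, hy⟩ := hf.exists_split
  have hv : Γ.E v := Γ.E.of_isPullback h hf.mem
  obtain ⟨D', d, p', hD⟩ := exists_isPullback hp g
  obtain ⟨P', x', y', hP'⟩ := exists_isPullback hv p'
  have h' := hP'.paste_horiz h
  obtain ⟨l, hl, hl'⟩ := hP.exists_lift (x' ≫ u) (y' ≫ d) (by rw [h'.w, Category.assoc, hD.w])
  refine isCovering_of_isPullback hM hB hv (Γ.E.of_isPullback hD hp) hP'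
    (hy.of_isPullback hM hB (IsPullback.of_right ?_ hl' hP))
  rwa [hl, hD.w]

/-- Coverings that are split epimorphisms are trivial. -/
theorem IsCovering.isTrivialCovering_of_section (h5 : CondE5 Γ.E) (hM : Γ.CondM) (hB : Γ.CondB)
    (hf : Γ.IsCovering f) {s : B ⟶ A} (hs : s ≫ f = 𝟙 B) : Γ.IsTrivialCovering f := by
  obtain ⟨D, P, p, x, y, hp, hP, hy⟩ := hf.exists_split
  -- As `f` is split, morphisms to `HI(P)` are tested in `HI(D)` and `HI(A)`. After pullback along
  -- `p`, triviality of `y` thus identifies any pair that `f` and the unit of `A` identify.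
  have hP' := isPullback_map h5 hM hB hf.mem hs hp hP.flip
  obtain ⟨Q, q₁, q₂, hQ⟩ := exists_isPullback (hB.unit_mem B) (Γ.HI.map f)
  obtain ⟨e, he₁, he₂⟩ := hQ.exists_lift f (Γ.unit A) (unit_naturality f)
  have he : Γ.E e := hB.comparison hf.mem hQ he₁ he₂
  obtain ⟨K, k₁, k₂, hK⟩ := exists_isPullback he e
  have hkf : k₁ ≫ f = k₂ ≫ f := by rw [← he₁, hK.w_assoc]
  have hku : k₁ ≫ Γ.unit A = k₂ ≫ Γ.unit A := by rw [← he₂, hK.w_assoc]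
  have hk : k₁ = k₂ := by
    obtain ⟨Z, r, q, hZ⟩ := exists_isPullback hp (k₁ ≫ f)
    refine hM.cancel (Γ.E.of_isPullback hZ hp) hf.mem hkf ?_
    obtain ⟨z₁, hz₁, hz₁'⟩ := hP.exists_lift (q ≫ k₁) r (by rw [hZ.w, Category.assoc])
    obtain ⟨z₂, hz₂, hz₂'⟩ := hP.exists_lift (q ≫ k₂) r (by rw [hZ.w, Category.assoc, hkf])
    have hz : z₁ = z₂ := by
      refine hy.hom_ext (by rw [hz₁', hz₂']) (hP'.hom_ext ?_ ?_)
      · rw [Category.assoc, Category.assoc, ← unit_naturality, reassoc_of% hz₁', reassoc_of% hz₂']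
      · rw [Category.assoc, Category.assoc, ← unit_naturality, reassoc_of% hz₁, reassoc_of% hz₂,
          hku]
    rw [← hz₁, ← hz₂, hz]
  refine isTrivialCovering_of_hom_ext hM hB hf.mem (fun Z u v h h' ↦ ?_)
  obtain ⟨l, hl, hl'⟩ := hK.exists_lift u v (hQ.hom_ext
    (by rw [Category.assoc, Category.assoc, he₁, h])
    (by rw [Category.assoc, Category.assoc, he₂, h']))
  rw [← hl, hk, hl']

/-- A factorization `f = q ≫ a'` of a morphism `f : A ⟶ B` in `E` through a covering, obtained by
descending the trivial covering associated with the kernel pair projection of `f`. -/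
structure CoveringReflection (Γ : GaloisStructure C) {A B : C} (f : A ⟶ B) where
  {obj R T : C}
  hom : obj ⟶ B
  q : A ⟶ obj
  (π₁ π₂ : R ⟶ A)
  t : R ⟶ T
  τ : T ⟶ A
  τ' : T ⟶ obj
  σ : T ⟶ Γ.HI.obj R
  isCovering : Γ.IsCovering hom
  q_mem : Γ.E q
  t_mem : Γ.E t
  fac : q ≫ hom = f
  isPullback_R : IsPullback π₁ π₂ f f
  isPullback_T : IsPullback τ' τ hom f
  isPullback_unit : IsPullback τ σ (Γ.unit A) (Γ.HI.map π₁)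
  t_τ : t ≫ τ = π₁
  t_τ' : t ≫ τ' = π₂ ≫ q
  t_σ : t ≫ σ = Γ.unit R

/-- The trivial covering `τ` obtained from the kernel pair projection inherits a descent datum along
`f` from composition in the equivalence relation `R`. -/
theorem exists_coveringReflection (h4 : CondE4 Γ.E) (h5 : CondE5 Γ.E) (hM : Γ.CondM)
    (hB : Γ.CondB) (hf : Γ.E f) : Nonempty (Γ.CoveringReflection f) := by
  obtain ⟨R, π₁, π₂, hR⟩ := exists_isPullback hf f
  have hπ₁ : Γ.E π₁ := Γ.E.of_isPullback hR.flip hf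
  have hπ₂ : Γ.E π₂ := Γ.E.of_isPullback hR hf
  obtain ⟨δ, hδ, -⟩ := hR.exists_lift (𝟙 A) (𝟙 A) rfl
  obtain ⟨T, τ, σ, hT⟩ := exists_isPullback (hB.unit_mem A) (Γ.HI.map π₁)
  have hτ : Γ.IsTrivialCovering τ := isTrivialCovering_of_isPullback_unit hM hB
    (Γ.I.obj R).property (Γ.map_mem π₁ hπ₁) hT
  obtain ⟨t, htτ, htσ⟩ := hT.exists_lift π₁ (Γ.unit R) (unit_naturality π₁)
  have ht : Γ.E t := hB.comparison hπ₁ hT htτ htσ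
  obtain ⟨N, n₁, n₂, hN⟩ := exists_isPullback (Γ.E.comp_mem _ _ hτ.1 hf) f
  obtain ⟨K, k₁, k₂, hK⟩ := exists_isPullback hπ₂ π₁
  -- `c` is composition in `R`, defined on the composable pairs `K`.
  obtain ⟨c, hc₁, hc₂⟩ := hR.exists_lift (k₁ ≫ π₁) (k₂ ≫ π₂) (by
    rw [Category.assoc, Category.assoc, ← hR.w, ← hK.w_assoc, hR.w])
  have hHK := isPullback_map h5 hM hB hπ₁ hδ hπ₂ hK
  obtain ⟨ρ, hρ₁, hρ₂⟩ := hR.exists_lift n₂ (n₁ ≫ τ) (by rw [← hN.w, Category.assoc])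
  -- An element of `T` only has a component in `HI(R)`. Since `HI(K)` is the pullback of composable
  -- pairs, it can still be composed there with an element of `R`; this defines the action `m`.
  obtain ⟨κ, hκ₁, hκ₂⟩ := hHK.exists_lift (ρ ≫ Γ.unit R) (n₁ ≫ σ) (by
    rw [Category.assoc, Category.assoc, ← unit_naturality, reassoc_of% hρ₂, hT.w])
  obtain ⟨m, hmτ, hmσ⟩ := hT.exists_lift n₂ (κ ≫ Γ.HI.map c) (by
    rw [Category.assoc, ← Functor.map_comp, hc₁, Functor.map_comp, ← Category.assoc, hκ₁,
      Category.assoc, ← unit_naturality, reassoc_of% hρ₁])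
  obtain ⟨A', a', q, τ', ha', hq, hT', e⟩ := hM.exists_quotient hf hR.flip hτ.1 ht htτ hN m hmτ
    (fun Z r r' x h₂ h h₁ ↦ by
      obtain ⟨l, hl₁, hl₂⟩ := hK.exists_lift (x ≫ ρ) r (by
        rw [Category.assoc, hρ₂, reassoc_of% h, htτ])
      have hl : l ≫ c = r' := by
        apply hR.hom_ext
        · rw [Category.assoc, hc₁, reassoc_of% hl₁, hρ₁, h₁]
        · rw [Category.assoc, hc₂, reassoc_of% hl₂, h₂]
      have hκ : x ≫ κ = l ≫ Γ.unit K := by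
        apply hHK.hom_ext
        · rw [Category.assoc, Category.assoc, hκ₁, ← unit_naturality, reassoc_of% hl₁]
        · rw [Category.assoc, Category.assoc, hκ₂, ← unit_naturality, reassoc_of% hl₂,
            reassoc_of% h, htσ]
      apply hT.hom_ext
      · rw [Category.assoc, Category.assoc, hmτ, htτ, h₁]
      · rw [Category.assoc, Category.assoc, hmσ, htσ, reassoc_of% hκ, ← unit_naturality,
          reassoc_of% hl])
  exact ⟨{
    hom := a'
    q := q
    π₁ := π₁
    π₂ := π₂
    t := t
    τ := τ
    τ' := τ'
    σ := σ
    isCovering := isCovering_of_isPullback hM hB ha' hf hT' hτ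
    q_mem := h4 π₂ q (e ▸ Γ.E.comp_mem _ _ ht (Γ.E.of_isPullback hT'.flip hf))
    t_mem := ht
    fac := hq
    isPullback_R := hR
    isPullback_T := hT'
    isPullback_unit := hT
    t_τ := htτ
    t_τ' := e
    t_σ := htσ }⟩

namespace CoveringReflection

variable (r : Γ.CoveringReflection f)

/-- As `q` is a coequalizer of its kernel pair relative to `E`, it suffices that `w` identifies that
kernel pair. -/
theorem exists_desc (h5 : CondE5 Γ.E) (hM : Γ.CondM) (hB : Γ.CondB) {D : C} {d : D ⟶ B}
    (hd : Γ.IsCovering d) {w : A ⟶ D} (h : w ≫ d = f) :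
    ∃ w' : r.obj ⟶ D, r.q ≫ w' = w ∧ w' ≫ d = r.hom := by
  obtain ⟨K, x, y, hK⟩ := exists_isPullback r.q_mem r.q
  refine hM.exists_factor r.q_mem hd.mem (h.trans r.fac.symm) hK ?_
  have hxy : x ≫ f = y ≫ f := by rw [← r.fac, hK.w_assoc]
  have hR := r.isPullback_R
  obtain ⟨ρ₁, h₁, h₁'⟩ := hR.exists_lift x x rfl
  obtain ⟨ρ₂, h₂, h₂'⟩ := hR.exists_lift x y hxy
  have ht : ρ₁ ≫ r.t = ρ₂ ≫ r.t := by
    apply r.isPullback_T.hom_ext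
    · rw [Category.assoc, Category.assoc, r.t_τ', reassoc_of% h₁', reassoc_of% h₂', hK.w]
    · rw [Category.assoc, Category.assoc, r.t_τ, h₁, h₂]
  obtain ⟨S, s₁, s₂, hS⟩ := exists_isPullback hd.mem f
  obtain ⟨s, -, hs⟩ := hS.exists_lift w (𝟙 A) (h.trans (Category.id_comp f).symm)
  -- The pullback of `d` along `f` is a covering with section induced by `w`, hence trivial. So the
  -- morphism `g` into it over `A` identifies what `t` identifies, here the pairs `(x, x)` and `(x,
  -- y)`.
  have hs₂ : Γ.IsTrivialCovering s₂ :=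
    (hd.of_isPullback hM hB hS).isTrivialCovering_of_section h5 hM hB hs
  obtain ⟨g, hg₁, hg₂⟩ := hS.exists_lift (r.π₂ ≫ w) r.π₁ (by rw [Category.assoc, h, hR.w])
  have key : ρ₁ ≫ g = ρ₂ ≫ g := by
    apply hs₂.hom_ext
    · rw [Category.assoc, Category.assoc, hg₂, h₁, h₂]
    · rw [Category.assoc, Category.assoc, unit_naturality, ← r.t_σ, Category.assoc,
        reassoc_of% ht]
  rw [← h₁', ← h₂', Category.assoc, Category.assoc, ← hg₁, reassoc_of% key]

end CoveringReflection

end GaloisStructure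

/-! ### Comparisons between covering reflections -/

namespace GaloisStructure

variable {C : Type u} [Category.{v} C] {Γ : GaloisStructure C}

namespace CoveringReflection

/-- The comparison of the square between the factorizations through coverings of two morphisms,
induced by a square in `E¹`, is in `E`. -/
theorem comparison_mem (h4 : CondE4 Γ.E) (h5 : CondE5 Γ.E) (hM : Γ.CondM) (hB : Γ.CondB)
    {a b : ExtCat Γ.E} {φ : a ⟶ b} (hφ : extClass Γ.E φ) (r : Γ.CoveringReflection a.obj.hom)
    (r' : Γ.CoveringReflection b.obj.hom) {g : r.obj ⟶ r'.obj}
    (hg : r.q ≫ g = φ.hom.left ≫ r'.q) (hg' : g ≫ r'.hom = r.hom ≫ φ.hom.right) {V : C}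
    {v₁ : V ⟶ b.obj.left} {v₂ : V ⟶ r.obj} (hV : IsPullback v₁ v₂ r'.q g)
    {c : a.obj.left ⟶ V} (hc₁ : c ≫ v₁ = φ.hom.left) (hc₂ : c ≫ v₂ = r.q) : Γ.E c := by
  have hw := Arrow.w φ.hom
  set f₁ : a.obj.left ⟶ b.obj.left := φ.hom.left with hf₁
  set f₀ : a.obj.right ⟶ b.obj.right := φ.hom.right with hf₀
  obtain ⟨P, p₀, p₁, hP⟩ := exists_isPullback hφ.2.1 b.obj.hom
  obtain ⟨e, he₀, he₁⟩ := hP.exists_lift a.obj.hom f₁ hw.symm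
  obtain ⟨u, hu₁, hu₂⟩ := r'.isPullback_R.exists_lift (r.π₁ ≫ f₁) (r.π₂ ≫ f₁) (by
    rw [Category.assoc, Category.assoc, hw, r.isPullback_R.w_assoc])
  have hu : Γ.E u := MorphismProperty.mem_of_isPullback_kernelPair hφ.1 b.property hw.symm hP
    (hφ.comparison hP he₀ he₁) he₀ he₁ r.isPullback_R r'.isPullback_R hu₁ hu₂
  obtain ⟨δ, hδ₁, hδ₂⟩ := r.isPullback_R.exists_lift (𝟙 _) (𝟙 _) rfl
  obtain ⟨δ', hδ₁', hδ₂'⟩ := r'.isPullback_R.exists_lift (𝟙 _) (𝟙 _) rfl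
  have hδu : δ ≫ u = f₁ ≫ δ' := by
    apply r'.isPullback_R.hom_ext
    · rw [Category.assoc, Category.assoc, hu₁, hδ₁', reassoc_of% hδ₁, Category.comp_id]
    · rw [Category.assoc, Category.assoc, hu₂, hδ₂', reassoc_of% hδ₂, Category.comp_id]
  obtain ⟨U, y₁, y₂, hU⟩ := exists_isPullback (hB.unit_mem r'.R) (Γ.HI.map u)
  obtain ⟨α, hα₁, hα₂⟩ := hU.exists_lift u (Γ.unit r.R) (unit_naturality u)
  obtain ⟨N, x₁, x₂, hN⟩ := exists_isPullback (hB.unit_mem b.obj.left) (Γ.HI.map f₁)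
  obtain ⟨β, hβ₁, hβ₂⟩ := hN.exists_lift f₁ (Γ.unit _) (unit_naturality f₁)
  obtain ⟨π, hπ₁, hπ₂⟩ := hN.exists_lift (y₁ ≫ r'.π₁) (y₂ ≫ Γ.HI.map r.π₁) (by
    rw [Category.assoc, unit_naturality, hU.w_assoc, ← Functor.map_comp, hu₁, Functor.map_comp,
      Category.assoc])
  obtain ⟨s, hs₁, hs₂⟩ := hU.exists_lift (x₁ ≫ δ') (x₂ ≫ Γ.HI.map δ) (by
    rw [Category.assoc, unit_naturality, hN.w_assoc, ← Functor.map_comp, ← hδu, Functor.map_comp,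
      Category.assoc])
  obtain ⟨T, hT₁, hT₂⟩ := r'.isPullback_unit.exists_lift (r.τ ≫ f₁) (r.σ ≫ Γ.HI.map u) (by
    rw [Category.assoc, unit_naturality, r.isPullback_unit.w_assoc, Category.assoc,
      ← Functor.map_comp, ← hu₁, Functor.map_comp])
  have hT : T ≫ r'.τ' = r.τ' ≫ g := by
    refine hM.cancel r.t_mem r'.isCovering.mem ?_ ?_
    · rw [Category.assoc, r'.isPullback_T.w, reassoc_of% hT₁, hw, Category.assoc, hg',
        r.isPullback_T.w_assoc]
    · have : r.t ≫ T = u ≫ r'.t := by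
        apply r'.isPullback_unit.hom_ext
        · rw [Category.assoc, Category.assoc, hT₁, r'.t_τ, hu₁, ← r.t_τ, Category.assoc]
        · rw [Category.assoc, Category.assoc, hT₂, r'.t_σ, unit_naturality, ← r.t_σ,
            Category.assoc]
      rw [reassoc_of% this, r'.t_τ', reassoc_of% hu₂, ← hg, ← Category.assoc r.t, r.t_τ',
        Category.assoc]
  obtain ⟨W, l₁, l₂, hW⟩ := exists_isPullback a.property (v₂ ≫ r.hom)
  obtain ⟨ω, hω₁, hω₂⟩ := r'.isPullback_R.exists_lift (l₁ ≫ f₁) (l₂ ≫ v₁) (by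
    rw [Category.assoc, Category.assoc, hw, hW.w_assoc, Category.assoc, ← hg', ← hV.w_assoc,
      r'.fac])
  obtain ⟨θ, hθ₁, hθ₂⟩ := r.isPullback_T.exists_lift (l₂ ≫ v₂) l₁ (by rw [hW.w, Category.assoc])
  have hωθ : ω ≫ r'.t = θ ≫ T := by
    apply r'.isPullback_T.hom_ext
    · rw [Category.assoc, Category.assoc, r'.t_τ', reassoc_of% hω₂, hT, reassoc_of% hθ₁, hV.w]
    · rw [Category.assoc, Category.assoc, r'.t_τ, hω₁, hT₁, reassoc_of% hθ₂]
  obtain ⟨γ, hγ₁, hγ₂⟩ := hU.exists_lift ω (θ ≫ r.σ) (by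
    rw [← r'.t_σ, reassoc_of% hωθ, hT₂, Category.assoc])
  -- `W` is the pullback of `π` and `β`: an element of `U` over `β x` yields a pair in `r'.R` and an
  -- element of `r.T` over `x`, whose images in `b.obj.left` and `r.obj` form an element of `V`.
  have hγ : IsPullback γ l₁ π β := by
    refine .mk' ?_ (fun Z φ φ' h h' ↦ ?_) (fun Z z x h ↦ ?_)
    · apply hN.hom_ext
      · rw [Category.assoc, Category.assoc, hπ₁, hβ₁, reassoc_of% hγ₁, hω₁]
      · rw [Category.assoc, Category.assoc, hπ₂, hβ₂, reassoc_of% hγ₂, ← r.isPullback_unit.w,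
          reassoc_of% hθ₂]
    · have hθ : φ ≫ θ = φ' ≫ θ := by
        apply r.isPullback_unit.hom_ext
        · rw [Category.assoc, Category.assoc, hθ₂, h']
        · rw [Category.assoc, Category.assoc, ← hγ₂, reassoc_of% h]
      refine hW.hom_ext h' (hV.hom_ext ?_ ?_)
      · rw [Category.assoc, Category.assoc, ← hω₂, ← hγ₁, Category.assoc, reassoc_of% h]
      · rw [Category.assoc, Category.assoc, ← hθ₁, reassoc_of% hθ]
    · obtain ⟨ζ, hζ₁, hζ₂⟩ := r.isPullback_unit.exists_lift x (z ≫ y₂) (by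
        rw [← hβ₂, ← reassoc_of% h, hπ₂, Category.assoc])
      have hζ : z ≫ y₁ ≫ r'.t = ζ ≫ T := by
        apply r'.isPullback_unit.hom_ext
        · rw [Category.assoc, Category.assoc, Category.assoc, r'.t_τ, hT₁, reassoc_of% hζ₁, ← hπ₁,
            reassoc_of% h, hβ₁]
        · rw [Category.assoc, Category.assoc, Category.assoc, r'.t_σ, hT₂, reassoc_of% hζ₂, hU.w]
      obtain ⟨ν, hν₁, hν₂⟩ := hV.exists_lift (z ≫ y₁ ≫ r'.π₂) (ζ ≫ r.τ') (by
        rw [Category.assoc, Category.assoc, Category.assoc, ← r'.t_τ', ← hT, ← reassoc_of% hζ])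
      obtain ⟨l, hl₁, hl₂⟩ := hW.exists_lift x ν (by
        rw [reassoc_of% hν₂, r.isPullback_T.w, reassoc_of% hζ₁])
      refine ⟨l, hU.hom_ext (r'.isPullback_R.hom_ext ?_ ?_) ?_, hl₁⟩
      · rw [Category.assoc, Category.assoc, Category.assoc, reassoc_of% hγ₁, hω₁,
          reassoc_of% hl₁, ← hπ₁, reassoc_of% h, hβ₁]
      · rw [Category.assoc, Category.assoc, Category.assoc, reassoc_of% hγ₁, hω₂,
          reassoc_of% hl₂, hν₁]
      · have : l ≫ θ = ζ := by
          apply r.isPullback_T.hom_ext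
          · rw [Category.assoc, hθ₁, reassoc_of% hl₂, hν₂]
          · rw [Category.assoc, hθ₂, hl₁, hζ₁]
        rw [Category.assoc, hγ₂, reassoc_of% this, hζ₂]
  obtain ⟨κ, hκ₁, hκ₂⟩ := hW.exists_lift r.π₁ (r.π₂ ≫ c) (by
    rw [Category.assoc, reassoc_of% hc₂, r.fac, r.isPullback_R.w])
  -- (E5) for the square from `α` to `β`, split by `δ` and `s`; (B) puts `α` and `β` in `E`.
  have hκ : Γ.E κ := by
    refine h5.comparison (a := α) (b := β) (f₁ := r.π₁) (f₀ := π) (s₁ := δ) (s₀ := s)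
      (hB.comparison hu hU hα₁ hα₂) (hB.comparison hφ.1 hN hβ₁ hβ₂) ?_ ?_ hδ₁ ?_ hγ ?_ hκ₁
    · apply hN.hom_ext
      · rw [Category.assoc, Category.assoc, hβ₁, hπ₁, reassoc_of% hα₁, hu₁]
      · rw [Category.assoc, Category.assoc, hβ₂, hπ₂, reassoc_of% hα₂, unit_naturality]
    · apply hU.hom_ext
      · rw [Category.assoc, Category.assoc, hα₁, hs₁, reassoc_of% hβ₁, hδu]
      · rw [Category.assoc, Category.assoc, hα₂, hs₂, reassoc_of% hβ₂, unit_naturality]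
    · apply hN.hom_ext
      · rw [Category.assoc, hπ₁, reassoc_of% hs₁, hδ₁', Category.comp_id, Category.id_comp]
      · rw [Category.assoc, hπ₂, ← Category.assoc, hs₂, Category.assoc, ← Functor.map_comp, hδ₁,
          CategoryTheory.Functor.map_id, Category.comp_id, Category.id_comp]
    · refine hU.hom_ext (r'.isPullback_R.hom_ext ?_ ?_) ?_
      · rw [Category.assoc κ, hγ₁, Category.assoc, hω₁, reassoc_of% hκ₁, hα₁, hu₁]
      · rw [Category.assoc κ, hγ₁, Category.assoc, hω₂, reassoc_of% hκ₂, hα₁, hu₂, hc₁]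
      · have : κ ≫ θ = r.t := by
          apply r.isPullback_T.hom_ext
          · rw [Category.assoc, hθ₁, reassoc_of% hκ₂, hc₂, r.t_τ']
          · rw [Category.assoc, hθ₂, hκ₁, r.t_τ]
        rw [Category.assoc, hγ₂, reassoc_of% this, r.t_σ, hα₂]
  refine h4 r.π₂ c ?_
  rw [← hκ₂]
  exact Γ.E.comp_mem _ _ hκ (Γ.E.of_isPullback hW a.property)

end CoveringReflection

end GaloisStructure

/-! ### Universal morphisms to full subcategories -/

namespace CategoryTheory.ObjectProperty

variable {D : Type u} [Category.{v} D] {X : ObjectProperty D}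

/-- A full subcategory is reflective if every object has a universal morphism to it. -/
theorem exists_adjunction_ι (h : ∀ a : D, ∃ (b : D) (_ : X b) (r : a ⟶ b),
    ∀ (d : D), X d → ∀ v : a ⟶ d, ∃! w : b ⟶ d, r ≫ w = v) :
    ∃ I : D ⥤ X.FullSubcategory, Nonempty (I ⊣ X.ι) := by
  choose b hb r hr using h
  let e (a : D) (Y : X.FullSubcategory) :
      ((⟨b a, hb a⟩ : X.FullSubcategory) ⟶ Y) ≃ (a ⟶ X.ι.obj Y) :=
    Equiv.ofBijective (fun w ↦ r a ≫ w.hom) ⟨fun w w' h ↦ by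
      ext
      exact (hr a Y.obj Y.property _).unique h rfl, fun v ↦ by
      obtain ⟨w, hw, -⟩ := hr a Y.obj Y.property v
      exact ⟨homMk w, hw⟩⟩
  exact ⟨_, ⟨Adjunction.adjunctionOfEquivLeft e
    (fun a Y Y' g h ↦ (Category.assoc _ _ _).symm)⟩⟩

/-- A universal morphism to a reflective full subcategory is isomorphic to the reflection unit. -/
theorem exists_iso_unit {I : D ⥤ X.FullSubcategory} (adj : I ⊣ X.ι) {a b : D} (hb : X b)
    (r : a ⟶ b) (hr : ∀ (d : D), X d → ∀ v : a ⟶ d, ∃! w : b ⟶ d, r ≫ w = v) :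
    ∃ i : b ≅ (I.obj a).obj, r ≫ i.hom = adj.unit.app a := by
  obtain ⟨w, hw, -⟩ := hr _ (I.obj a).property (adj.unit.app a)
  let w' : I.obj a ⟶ ⟨b, hb⟩ := (adj.homEquiv a ⟨b, hb⟩).symm r
  have hw' : adj.unit.app a ≫ w'.hom = r :=
    (adj.homEquiv_unit _ _ _).symm.trans ((adj.homEquiv a ⟨b, hb⟩).apply_symm_apply r)
  refine ⟨⟨w, w'.hom, ?_, ?_⟩, hw⟩
  · exact (hr b hb r).unique (by rw [← Category.assoc, hw, hw']) (Category.comp_id _)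
  · have : w' ≫ homMk w = 𝟙 (I.obj a) := by
      apply (adj.homEquiv _ _).injective
      rw [adj.homEquiv_unit, adj.homEquiv_unit]
      change adj.unit.app a ≫ w'.hom ≫ w = adj.unit.app a ≫ 𝟙 _
      rw [← Category.assoc, hw', hw, Category.comp_id]
    exact congrArg (fun k ↦ k.hom) this

end CategoryTheory.ObjectProperty

/-! ### The reflection of `Ext(C)` and its effect on `E¹` -/

namespace GaloisStructure

variable {C : Type u} [Category.{v} C] {Γ : GaloisStructure C}

theorem isClosedUnderIsomorphisms_cov (hM : Γ.CondM) (hB : Γ.CondB) :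
    Γ.Cov.IsClosedUnderIsomorphisms where
  of_iso {a b} i ha := by
    have hl : IsIso i.inv.hom.left := inferInstanceAs
      (IsIso (((ExtCat.incl Γ.E ⋙ Arrow.leftFunc).mapIso i).inv))
    have hr : IsIso i.inv.hom.right := inferInstanceAs
      (IsIso (((ExtCat.incl Γ.E ⋙ Arrow.rightFunc).mapIso i).inv))
    exact IsCovering.of_isPullback hM hB ha
      (IsPullback.of_horiz_isIso ⟨Arrow.w i.inv.hom⟩)

namespace CoveringReflection

variable {a b : ExtCat Γ.E} (r : Γ.CoveringReflection a.obj.hom)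
  (r' : Γ.CoveringReflection b.obj.hom)

/-- The covering of a `CoveringReflection`, as an object of `Ext(C)`. -/
abbrev ext : ExtCat Γ.E := ExtCat.mk r.hom r.isCovering.mem

/-- The morphism of `Ext(C)` to the covering of a `CoveringReflection`. -/
abbrev unit : a ⟶ r.ext :=
  ObjectProperty.homMk (Arrow.homMk r.q (𝟙 _) (r.fac.trans (Category.comp_id _).symm))

/-- Pulling `d` back along the codomain component of `v` reduces existence to a fixed codomain;
uniqueness is cancellation of `r.q` relative to `d`. -/
theorem existsUnique_desc (h5 : CondE5 Γ.E) (hM : Γ.CondM) (hB : Γ.CondB) (d : ExtCat Γ.E)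
    (hd : Γ.Cov d) (v : a ⟶ d) : ∃! w : r.ext ⟶ d, r.unit ≫ w = v := by
  obtain ⟨D, d₁, d₂, hD⟩ := exists_isPullback d.property v.hom.right
  obtain ⟨l, hl₁, hl₂⟩ := hD.exists_lift v.hom.left a.obj.hom (Arrow.w v.hom)
  obtain ⟨w, hw, hw'⟩ := r.exists_desc h5 hM hB (IsCovering.of_isPullback hM hB hd hD) hl₂
  refine ⟨ObjectProperty.homMk (Arrow.homMk (w ≫ d₁) v.hom.right ?_), ?_, fun z hz ↦ ?_⟩
  · change (w ≫ d₁) ≫ d.obj.hom = r.hom ≫ v.hom.right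
    rw [Category.assoc, hD.w, reassoc_of% hw']
  · ext
    · change r.q ≫ w ≫ d₁ = v.hom.left
      rw [reassoc_of% hw, hl₁]
    · exact Category.id_comp _
  · have h₁ : r.q ≫ z.hom.left = v.hom.left := congrArg (fun k ↦ k.hom.left) hz
    have h₀ : z.hom.right = v.hom.right :=
      (Category.id_comp _).symm.trans (congrArg (fun k ↦ k.hom.right) hz)
    have h := Arrow.w z.hom
    ext
    · refine hM.cancel r.q_mem d.property ?_ ?_
      · change z.hom.left ≫ d.obj.hom = (w ≫ d₁) ≫ d.obj.hom
        rw [Category.assoc, hD.w, reassoc_of% hw', h, h₀]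
        rfl
      · change r.q ≫ z.hom.left = r.q ≫ w ≫ d₁
        rw [h₁, reassoc_of% hw, hl₁]
    · exact h₀

theorem unit_mem : extClass Γ.E r.unit :=
  extClass_of_isIso_right _ r.q_mem (inferInstanceAs (IsIso (𝟙 _)))

variable {r r'} {φ : a ⟶ b} {g : r.ext ⟶ r'.ext}

/-- Precomposed with `r.q`, the domain component and the comparison of `g` become composites of
morphisms in `E`, so (E4) applies. This is (G) for the new structure. -/
theorem extClass_of_comm (h4 : CondE4 Γ.E) (hφ : extClass Γ.E φ)
    (hg : r.unit ≫ g = φ ≫ r'.unit) : extClass Γ.E g := by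
  have hg₁ : r.q ≫ g.hom.left = φ.hom.left ≫ r'.q := congrArg (fun k ↦ k.hom.left) hg
  have hg₀ : g.hom.right = φ.hom.right := (Category.id_comp _).symm.trans
    ((congrArg (fun k ↦ k.hom.right) hg).trans (Category.comp_id _))
  have h₀ : Γ.E g.hom.right := hg₀ ▸ hφ.2.1
  obtain ⟨P, p₀, p₁, hP⟩ := exists_isPullback h₀ r'.hom
  obtain ⟨P', p₀', p₁', hP'⟩ := exists_isPullback h₀ b.obj.hom
  obtain ⟨e, he₀, he₁⟩ := hP.exists_lift r.hom g.hom.left (Arrow.w g.hom).symm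
  obtain ⟨c, hc₀, hc₁⟩ := hP'.exists_lift a.obj.hom φ.hom.left
    (by rw [hg₀]; exact (Arrow.w φ.hom).symm)
  obtain ⟨s, hs₀, hs₁⟩ := hP.exists_lift p₀' (p₁' ≫ r'.q) (by
    rw [Category.assoc, r'.fac]; exact hP'.w)
  have hs : IsPullback s p₁' p₁ r'.q := by
    refine IsPullback.of_right ?_ hs₁ hP
    rw [hs₀, r'.fac]
    exact hP'
  have hc : Γ.E c := hφ.comparison (by rw [← hg₀]; exact hP') hc₀ hc₁
  have h : r.q ≫ e = c ≫ s := by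
    apply hP.hom_ext
    · rw [Category.assoc, Category.assoc, he₀, hs₀, hc₀, r.fac]
    · rw [Category.assoc, Category.assoc, he₁, hs₁, reassoc_of% hc₁, hg₁]
  refine extClass_of_comparison g (h4 r.q _ ?_) h₀ hP (h4 r.q e ?_) he₀ he₁
  · rw [hg₁]
    exact Γ.E.comp_mem _ _ hφ.1 r'.q_mem
  · rw [h]
    exact Γ.E.comp_mem _ _ hc (Γ.E.of_isPullback hs.flip r'.q_mem)

/-- The units are identities on codomains, so `c` is invertible there and only its domain component
matters; that is `comparison_mem`. -/
theorem extClass_comparison (h4 : CondE4 Γ.E) (h5 : CondE5 Γ.E) (hM : Γ.CondM) (hB : Γ.CondB)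
    (hφ : extClass Γ.E φ) (hg : r.unit ≫ g = φ ≫ r'.unit) {V : ExtCat Γ.E} {v₁ : V ⟶ b}
    {v₂ : V ⟶ r.ext} (hV : IsPullback v₁ v₂ r'.unit g) {c : a ⟶ V} (hc₁ : c ≫ v₁ = φ)
    (hc₂ : c ≫ v₂ = r.unit) : extClass Γ.E c := by
  obtain ⟨hl, hr⟩ := r'.unit_mem.isPullback hV
  have : IsIso v₂.hom.right := hr.isIso_snd_of_isIso (inferInstanceAs (IsIso (𝟙 _)))
  have h₀ : c.hom.right ≫ v₂.hom.right = 𝟙 _ := congrArg (fun k ↦ k.hom.right) hc₂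
  have hg₁ : r.q ≫ g.hom.left = φ.hom.left ≫ r'.q := congrArg (fun k ↦ k.hom.left) hg
  have hg₀ : g.hom.right = φ.hom.right := (Category.id_comp _).symm.trans
    ((congrArg (fun k ↦ k.hom.right) hg).trans (Category.comp_id _))
  have hw : g.hom.left ≫ r'.hom = r.hom ≫ φ.hom.right := by
    rw [← hg₀]
    exact Arrow.w g.hom
  refine extClass_of_isIso_right c
    (comparison_mem h4 h5 hM hB hφ r r' hg₁ hw hl (congrArg (fun k ↦ k.hom.left) hc₁)
      (congrArg (fun k ↦ k.hom.left) hc₂)) ?_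
  have : IsIso (c.hom.right ≫ v₂.hom.right) := h₀ ▸ inferInstanceAs (IsIso (𝟙 a.obj.right))
  exact IsIso.of_isIso_comp_right c.hom.right v₂.hom.right

end CoveringReflection

end GaloisStructure

/-! ### The Galois structure on `Ext(C)` -/

open GaloisStructure

theorem mainTheorem4 {C : Type u} [Category.{v} C] (Γ : GaloisStructure C)
    (hE4 : CondE4 Γ.E) (hE5 : CondE5 Γ.E) (hM : Γ.CondM) (hB : Γ.CondB) :
    (∃ Γ₁ : GaloisStructure (ExtCat Γ.E), Γ₁.X = Γ.Cov ∧ Γ₁.E = extClass Γ.E) ∧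
    ∀ Γ₁ : GaloisStructure (ExtCat Γ.E), Γ₁.X = Γ.Cov → Γ₁.E = extClass Γ.E → Γ₁.CondB := by
  have R (a : ExtCat Γ.E) : Γ.CoveringReflection a.obj.hom :=
    (exists_coveringReflection hE4 hE5 hM hB a.property).some
  have hR (a : ExtCat Γ.E) := (R a).existsUnique_desc hE5 hM hB
  constructor
  · obtain ⟨I, ⟨adj⟩⟩ := ObjectProperty.exists_adjunction_ι (X := Γ.Cov) fun a ↦
      ⟨(R a).ext, (R a).isCovering, (R a).unit, hR a⟩
    refine ⟨{
      X := Γ.Cov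
      replete := isClosedUnderIsomorphisms_cov hM hB
      I := I
      adj := adj
      E := extClass Γ.E
      iso_mem := fun _ _ f _ ↦ MorphismProperty.of_isIso _ f
      hasPullback := fun _ _ _ f g hf ↦ (hf.2.2 g).1
      stable := inferInstance
      comp_mem := fun _ _ _ f g hf hg ↦ MorphismProperty.comp_mem _ f g hf hg
      map_mem := fun a b φ hφ ↦ ?_ }, rfl, rfl⟩
    obtain ⟨i, hi⟩ := ObjectProperty.exists_iso_unit adj (b := (R a).ext) (R a).isCovering (R a).unit (hR a)
    obtain ⟨j, hj⟩ := ObjectProperty.exists_iso_unit adj (b := (R b).ext) (R b).isCovering (R b).unit (hR b)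
    have hn : φ ≫ adj.unit.app b = adj.unit.app a ≫ (I ⋙ Γ.Cov.ι).map φ := adj.unit.naturality φ
    have h := CoveringReflection.extClass_of_comm (r := R a) (r' := R b)
      (g := i.hom ≫ (I ⋙ Γ.Cov.ι).map φ ≫ j.inv) hE4 hφ (by
        rw [← Category.assoc, hi, ← Category.assoc, ← hn, ← hj, Category.assoc, Category.assoc,
          j.hom_inv_id, Category.comp_id])
    exact ((extClass Γ.E).cancel_right_of_respectsIso _ j.inv).1
      (((extClass Γ.E).cancel_left_of_respectsIso i.hom _).1 h)
  · intro Γ₁ hX hE a b φ hφ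
    obtain ⟨i, hi⟩ := ObjectProperty.exists_iso_unit Γ₁.adj (hX ▸ (R a).isCovering) (R a).unit
      (hX ▸ hR a)
    obtain ⟨j, hj⟩ := ObjectProperty.exists_iso_unit Γ₁.adj (hX ▸ (R b).isCovering) (R b).unit
      (hX ▸ hR b)
    replace hi : (R a).unit ≫ i.hom = Γ₁.unit a := hi
    replace hj : (R b).unit ≫ j.hom = Γ₁.unit b := hj
    have ha : Γ₁.E (Γ₁.unit a) := by
      rw [hE]
      exact hi ▸ MorphismProperty.comp_mem _ _ _ (R a).unit_mem (MorphismProperty.of_isIso _ _)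
    have hb : Γ₁.E (Γ₁.unit b) := by
      rw [hE]
      exact hj ▸ MorphismProperty.comp_mem _ _ _ (R b).unit_mem (MorphismProperty.of_isIso _ _)
    obtain ⟨P, p₀, p₁, hP⟩ := exists_isPullback hb (Γ₁.HI.map φ)
    obtain ⟨e, he₀, he₁⟩ := hP.exists_lift φ (Γ₁.unit a) (unit_naturality φ)
    -- The comparison criterion is used one level up, in `Ext(C)` with the class `Γ₁.E`.
    refine extClass_of_comparison (E := Γ₁.E) (Γ₁.unitSquare φ hφ) ha hb hP (e := e) ?_ he₀ he₁
    rw [hE] at hφ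
    have he : extClass Γ.E e := by
      refine CoveringReflection.extClass_comparison (r := R a) (r' := R b) hE4 hE5 hM hB hφ
        (g := i.hom ≫ Γ₁.HI.map φ ≫ j.inv) (v₁ := p₀) (v₂ := p₁ ≫ i.inv) ?_ ?_ he₀ ?_
      · rw [← Category.assoc, hi, ← Category.assoc, ← unit_naturality, ← hj, Category.assoc,
          Category.assoc, j.hom_inv_id, Category.comp_id]
      · refine hP.of_iso (Iso.refl _) (Iso.refl _) i.symm j.symm ?_ ?_ ?_ ?_
        · simp
        · simp
        · rw [← hj]; simp
        · simp
      · rw [← Category.assoc, he₁, ← hi, Category.assoc, i.hom_inv_id, Category.comp_id]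
    exact (congrFun (congrFun (congrFun hE _) _) e).mpr he
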